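/- **Setting.** Let $\Lambda\subset\mathbb R^2$ be a lattice and $\Omega=\Omega_1\cup\Omega_2$ a fundamental domain of $\Lambda$ (for instance its Wigner--Seitz cell), with $\Omega_1,\Omega_2$ disjoint and measurable and with indicator functions $\chi_1,\chi_2$. Let $V=H^1_{\mathrm{per}}(\Omega)$ be the complex Sobolev space of $\Lambda$-periodic functions with the standard $H^1$-norm, $V^*$ the space of bounded conjugate-linear functionals on $V$, $\mathbf k\in\mathbb R^2$, $\nabla_{\mathbf k}=\nabla+i\mathbf k$ and $\alpha_1>0$. Let $S\subset\mathbb R$ be open and connected and let $\varepsilon_2$ be real-valued and real analytic on $S$ with $0<C_0\le|\varepsilon_2(\omega)|\le C_1<\infty$ and $\varepsilon_2(-\omega)=\varepsilon_2(\omega)$ for $\omega\in S$. Then there are an open set $D\subset\mathbb C$, $D\supset S$, symmetric with respect to the real axis, and a holomorphic extension of $\varepsilon_2$ to $D$, again denoted $\varepsilon_2$, with $\varepsilon_2(\overline\omega)=\overline{\varepsilon_2(\omega)}$. Fix any such $D$ and extension and put, for $\omega\in D$, $\mathcal T(\omega)=\mathcal A-\mathcal B(\omega):V\to V^*$, where $$\langle\mathcal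 A u,v\rangle=\int_\Omega\nabla_{\mathbf k}u\cdot\overline{\nabla_{\mathbf k}v}\,dx,\qquad \langle\mathcal B(\omega)u,v\rangle=\omega^2\int_\Omega\big(\alpha_1\chi_1+\varepsilon_2(\omega)\chi_2\big)u\,\overline v\,dx .$$ Let $\omega^*\in S$ and $0\ne u^*\in V$ satisfy $\mathcal T(\omega^*)u^*=0$, and let the eigenvalue $\omega^*$ be simple: $\dim\ker\mathcal T(\omega^*)=1$ and every Jordan chain of $\mathcal T$ at $\omega^*$ has length one. Let $y\in V$ and $P_yu=\int_\Omega u\,\overline y\,dx$, with $P_yu^*\neq0$. Normalise the eigenfunction, i.e. put $\hat u=u^*/P_yu^*$. On $V\times\mathbb C$ let $\|(u,\omega)\|^2=\|u\|_V^2+|\omega|^2$. **Claim.** There are $\delta>0$ and $C\in\mathbb R$ such that the following holds. 1. If $|\omega-\omega^*|<\delta$, then $\omega\in D$, and if moreover $\omega\ne\omega^*$, then $\mathcal T(\omega)$ has a bounded inverse. 2. Let $(u^0,\omega^0)\in V\times\mathbb C$ satisfy $\|(u^0,\omega^0)-(\hat u,\omega^*)\|<\delta$, $P_yu^0=1$ and,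 if $\omega^0\neq\omega^*$, $P_y\mathcal T(\omega^0)^{-1}\mathcal T'(\omega^0)u^0\neq0$. Then the Newton iteration $u^{j+1}=u^j+s^j$, $\omega^{j+1}=\omega^j+\nu^j$ with $$\begin{bmatrix}\mathcal T(\omega^j)&\mathcal T'(\omega^j)u^j\\ P_y&0\end{bmatrix}\begin{bmatrix}s^j\\ \nu^j\end{bmatrix}=-\begin{bmatrix}\mathcal T(\omega^j)u^j\\0\end{bmatrix},\qquad j=0,1,2,\dots,$$ is well defined: for every $j$, $\omega^j\in D$ and the block operator $V\times\mathbb C\to V^*\times\mathbb C$ on the left has a bounded inverse. Moreover $P_yu^j=1$ for all $j$, $(u^j,\omega^j)\to(\hat u,\omega^*)$, and the convergence is quadratic: $$\|(u^{j+1},\omega^{j+1})-(\hat u,\omega^*)\|\le C\,\|(u^j,\omega^j)-(\hat u,\omega^*)\|^2\qquad\text{for all }j\ge 0 .$$ -/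

import Mathlib

open MeasureTheory Filter Topology
open scoped ComplexConjugate

namespace PhotonicNewton

noncomputable section

/-- The Euclidean plane. -/
abbrev Plane : Type := EuclideanSpace ℝ (Fin 2)

/-- The complex Hilbert space `L²(Ω)`. -/
abbrev L2 (Ω : Set Plane) : Type := Lp ℂ 2 (volume.restrict Ω)

/-- The partial derivative `∂ⱼ φ`. -/
def partialDeriv (j : Fin 2) (φ : Plane → ℂ) (x : Plane) : ℂ :=
  fderiv ℝ φ x (EuclideanSpace.single j 1)

/-- Periodic test functions: smooth functions on the plane that are periodic with respect to the
lattice `Λ`. When `Ω` is a fundamental domain of `Λ`, which is the only case used, `Ω` has finite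
measure and a smooth periodic function is bounded together with its derivatives, so that the two
square-integrability clauses hold automatically; they keep the definition of `H¹_per` below
meaningful for every set `Ω`. -/
structure IsPeriodicTest (Λ : Submodule ℤ Plane) (Ω : Set Plane) (φ : Plane → ℂ) : Prop where
  smooth : ContDiff ℝ (⊤ : ℕ∞) φ
  periodic : ∀ l ∈ Λ, ∀ x, φ (x + l) = φ x
  memLp : MemLp φ 2 (volume.restrict Ω)
  memLp_partialDeriv : ∀ j, MemLp (partialDeriv j φ) 2 (volume.restrict Ω)

/-- The ambient Hilbert space of all pairs `(u, g)`, `u ∈ L²(Ω)`, `g ∈ L²(Ω)²`, with norm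
`(‖u‖² + ‖g₁‖² + ‖g₂‖²)^(1/2)`. -/
abbrev L2Jet (Ω : Set Plane) : Type := WithLp 2 (L2 Ω × PiLp 2 (fun _ : Fin 2 => L2 Ω))

lemma integrable_mul_of_memLp {Ω : Set Plane} (f : L2 Ω) {φ : Plane → ℂ}
    (hφ : MemLp φ 2 (volume.restrict Ω)) :
    Integrable (fun x => f x * φ x) (volume.restrict Ω) :=
  (Lp.memLp f).integrable_mul hφ

/-- The periodic Sobolev space `H¹_per(Ω)` with the standard `H¹`-norm. Its elements are the pairs
`(u, ∇u)` where `u ∈ L²(Ω)` has the weak gradient `∇u ∈ L²(Ω)²` as a `Λ`-periodic function: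
`∫_Ω u ∂ⱼφ = - ∫_Ω (∂ⱼu) φ` for all smooth `Λ`-periodic `φ`. (The gradient is determined by `u`.) -/
def periodicH1 (Λ : Submodule ℤ Plane) (Ω : Set Plane) : Submodule ℂ (L2Jet Ω) where
  carrier := {p | ∀ φ : Plane → ℂ, IsPeriodicTest Λ Ω φ → ∀ j : Fin 2,
    ∫ x in Ω, p.fst x * partialDeriv j φ x = - ∫ x in Ω, p.snd j x * φ x}
  zero_mem' := by
    intro φ hφ j
    have h0 : ∀ᵐ x ∂(volume.restrict Ω), (0 : L2 Ω) x = 0 := Lp.coeFn_zero _ _ _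
    have h1 : ∫ x in Ω, (0 : L2 Ω) x * partialDeriv j φ x = 0 :=
      integral_eq_zero_of_ae (by filter_upwards [h0] with x hx; rw [hx]; simp)
    have h2 : ∫ x in Ω, (0 : L2 Ω) x * φ x = 0 :=
      integral_eq_zero_of_ae (by filter_upwards [h0] with x hx; rw [hx]; simp)
    change ∫ x in Ω, (0 : L2 Ω) x * partialDeriv j φ x = - ∫ x in Ω, (0 : L2 Ω) x * φ x
    rw [h1, h2, neg_zero]
  add_mem' := by
    intro p q hp hq φ hφ j
    have key : ∀ (f g : L2 Ω) (ψ : Plane → ℂ), MemLp ψ 2 (volume.restrict Ω) →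
        ∫ x in Ω, (f + g) x * ψ x = (∫ x in Ω, f x * ψ x) + ∫ x in Ω, g x * ψ x := by
      intro f g ψ hψ
      rw [← integral_add (integrable_mul_of_memLp f hψ) (integrable_mul_of_memLp g hψ)]
      refine integral_congr_ae ?_
      filter_upwards [Lp.coeFn_add f g] with x hx
      rw [hx, Pi.add_apply, add_mul]
    change ∫ x in Ω, (p.fst + q.fst) x * partialDeriv j φ x
      = - ∫ x in Ω, (p.snd j + q.snd j) x * φ x
    rw [key _ _ _ (hφ.memLp_partialDeriv j), key _ _ _ hφ.memLp, hp φ hφ j, hq φ hφ j, neg_add]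
  smul_mem' := by
    intro c p hp φ hφ j
    have key : ∀ (f : L2 Ω) (ψ : Plane → ℂ),
        ∫ x in Ω, (c • f) x * ψ x = c * ∫ x in Ω, f x * ψ x := by
      intro f ψ
      rw [← integral_const_mul]
      refine integral_congr_ae ?_
      filter_upwards [Lp.coeFn_smul c f] with x hx
      rw [hx, Pi.smul_apply, smul_eq_mul, mul_assoc]
    change ∫ x in Ω, (c • p.fst) x * partialDeriv j φ x = - ∫ x in Ω, (c • p.snd j) x * φ x
    rw [key, key, hp φ hφ j, mul_neg]

/-- The space `V = H¹_per(Ω)` as a type, with the norm `(‖u‖² + ‖∂₁u‖² + ‖∂₂u‖²)^(1/2)`. -/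
def H1per (Λ : Submodule ℤ Plane) (Ω : Set Plane) : Type := periodicH1 Λ Ω

instance (Λ : Submodule ℤ Plane) (Ω : Set Plane) : NormedAddCommGroup (H1per Λ Ω) :=
  inferInstanceAs (NormedAddCommGroup (periodicH1 Λ Ω))

instance (Λ : Submodule ℤ Plane) (Ω : Set Plane) : InnerProductSpace ℂ (H1per Λ Ω) :=
  inferInstanceAs (InnerProductSpace ℂ (periodicH1 Λ Ω))

section Operators

variable {Λ : Submodule ℤ Plane} {Ω : Set Plane}

/-- The inclusion `u ↦ (u, ∇u)`. -/
def jet : H1per Λ Ω →L[ℂ] L2Jet Ω := (periodicH1 Λ Ω).subtypeL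

/-- The embedding `H¹_per(Ω) → L²(Ω)`. -/
def value : H1per Λ Ω →L[ℂ] L2 Ω :=
  (WithLp.fstL 2 ℂ (L2 Ω) (PiLp 2 (fun _ : Fin 2 => L2 Ω))).comp jet

/-- The weak partial derivative `u ↦ ∂ⱼu`, `H¹_per(Ω) → L²(Ω)`. -/
def weakPartial (j : Fin 2) : H1per Λ Ω →L[ℂ] L2 Ω :=
  ((PiLp.proj 2 (fun _ : Fin 2 => L2 Ω) j).comp
    (WithLp.sndL 2 ℂ (L2 Ω) (PiLp 2 (fun _ : Fin 2 => L2 Ω)))).comp jet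

/-- The `j`-th component `∂ⱼu + i kⱼ u` of the shifted gradient `∇ₖ u = ∇u + i k u`. -/
def shiftedPartial (k : Plane) (j : Fin 2) : H1per Λ Ω →L[ℂ] L2 Ω :=
  weakPartial j + (Complex.I * (k j : ℂ)) • value

end Operators

/-- The conjugate dual `V*`: bounded conjugate-linear functionals on `V`. -/
abbrev ConjDual (V : Type*) [NormedAddCommGroup V] [NormedSpace ℂ V] : Type _ := V →L⋆[ℂ] ℂ

/-- For a bounded operator `G` from `V` into a Hilbert space, the operator `V → V*` given by the
form `(u, v) ↦ (G u, G v)`, linear in `u` and conjugate-linear in `v`. -/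
def pullbackForm {V H : Type*} [NormedAddCommGroup V] [NormedSpace ℂ V]
    [NormedAddCommGroup H] [InnerProductSpace ℂ H] (G : V →L[ℂ] H) : V →L[ℂ] ConjDual V :=
  (innerSL ℂ (E := H)).flip.bilinearComp G G

lemma pullbackForm_apply {V H : Type*} [NormedAddCommGroup V] [NormedSpace ℂ V]
    [NormedAddCommGroup H] [InnerProductSpace ℂ H] (G : V →L[ℂ] H) (u v : V) :
    pullbackForm G u v = inner ℂ (G v) (G u) := rfl

section Forms

variable {Λ : Submodule ℤ Plane} {Ω : Set Plane}

/-- The operator `A : V → V*`, `⟨A u, v⟩ = ∫_Ω ∇ₖu · conj (∇ₖv)`. -/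
def opA (k : Plane) : H1per Λ Ω →L[ℂ] ConjDual (H1per Λ Ω) :=
  ∑ j : Fin 2, pullbackForm (shiftedPartial k j)

/-- The operator `V → V*` given by `(u, v) ↦ ∫_{Ω'} u conj v`, for a measurable part `Ω'`
of `Ω`. -/
def massOn (Ω' : Set Plane) : H1per Λ Ω →L[ℂ] ConjDual (H1per Λ Ω) :=
  pullbackForm ((LpToLpRestrictCLM Plane ℂ ℂ (volume.restrict Ω) 2 Ω').comp value)

/-- The operator `B(ω) : V → V*`,
`⟨B(ω) u, v⟩ = ω² ∫_Ω (α₁ χ₁ + ε₂(ω) χ₂) u conj v`, with `χⱼ` the indicator function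
of `Ωⱼ`. -/
def opB (Ω₁ Ω₂ : Set Plane) (α₁ : ℝ) (ε : ℂ → ℂ) (ω : ℂ) :
    H1per Λ Ω →L[ℂ] ConjDual (H1per Λ Ω) :=
  ω ^ 2 • ((α₁ : ℂ) • massOn Ω₁ + ε ω • massOn Ω₂)

/-- The operator `T(ω) = A - B(ω)`. -/
def opT (Λ : Submodule ℤ Plane) (Ω Ω₁ Ω₂ : Set Plane) (k : Plane) (α₁ : ℝ) (ε : ℂ → ℂ) (ω : ℂ) :
    H1per Λ Ω →L[ℂ] ConjDual (H1per Λ Ω) :=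
  opA k - opB Ω₁ Ω₂ α₁ ε ω

/-- The linear functional `P_y u = ∫_Ω u conj y`. -/
def functionalP (y : H1per Λ Ω) : H1per Λ Ω →L[ℂ] ℂ :=
  (innerSL ℂ (value y)).comp value

lemma opA_apply (k : Plane) (u v : H1per Λ Ω) :
    opA k u v = ∑ j : Fin 2, ∫ x in Ω, shiftedPartial k j u x * conj (shiftedPartial k j v x) := by
  simp [opA, pullbackForm_apply, L2.inner_def]

lemma functionalP_apply (y u : H1per Λ Ω) :
    functionalP y u = ∫ x in Ω, value u x * conj (value y x) := by
  simp [functionalP, L2.inner_def]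

lemma opB_apply {Ω₁ Ω₂ : Set Plane} (h₁ : MeasurableSet Ω₁) (h₂ : MeasurableSet Ω₂) (α₁ : ℝ)
    (ε : ℂ → ℂ) (ω : ℂ) (u v : H1per Λ Ω) :
    opB Ω₁ Ω₂ α₁ ε ω u v = ω ^ 2 * ∫ x in Ω,
      ((α₁ : ℂ) * Ω₁.indicator 1 x + ε ω * Ω₂.indicator 1 x) * value u x
        * conj (value v x) := by
  have hm : ∀ {Ω' : Set Plane}, MeasurableSet Ω' → massOn Ω' u v
      = ∫ x in Ω, Ω'.indicator 1 x * (value u x * conj (value v x)) := by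
    intro Ω' h
    have e1 : massOn Ω' u v
        = ∫ x in Ω', value u x * conj (value v x) ∂(volume.restrict Ω) := by
      rw [massOn, pullbackForm_apply, L2.inner_def]
      refine integral_congr_ae ?_
      filter_upwards [LpToLpRestrictCLM_coeFn (p := 2) ℂ Ω' (value u),
        LpToLpRestrictCLM_coeFn (p := 2) ℂ Ω' (value v)] with x hu hv
      simp [hu, hv]
    rw [e1, ← integral_indicator h]
    refine integral_congr_ae (Eventually.of_forall fun x => ?_)
    by_cases hx : x ∈ Ω' <;> simp [hx]
  have hi : Integrable (fun x => value u x * conj (value v x)) (volume.restrict Ω) := by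
    have := L2.integrable_inner (𝕜 := ℂ) (value v) (value u)
    simpa using this
  have hint : ∀ {Ω' : Set Plane}, MeasurableSet Ω' → Integrable
      (fun x => Ω'.indicator (1 : Plane → ℂ) x * (value u x * conj (value v x)))
        (volume.restrict Ω) := by
    intro Ω' h
    refine (hi.indicator h).congr (Eventually.of_forall fun x => ?_)
    by_cases hx : x ∈ Ω' <;> simp [hx]
  have e2 : opB Ω₁ Ω₂ α₁ ε ω u v
      = ω ^ 2 * ((α₁ : ℂ) * massOn Ω₁ u v + ε ω * massOn Ω₂ u v) := rfl
  rw [e2, hm h₁, hm h₂, ← integral_const_mul, ← integral_const_mul,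
    ← integral_add ((hint h₁).const_mul _) ((hint h₂).const_mul _)]
  congr 2
  ext x
  ring

end Forms

/-- `D` is an open neighbourhood of `S ⊆ ℝ` in `ℂ`, symmetric with respect to the real axis, and
`ε` is a holomorphic extension to `D` of the real function `ε₂` on `S` that respects complex
conjugation (so that `T(conj ω)` is the adjoint of `T(ω)`). -/
structure IsHolomorphicExtension (ε₂ : ℝ → ℝ) (S : Set ℝ) (D : Set ℂ) (ε : ℂ → ℂ) : Prop where
  isOpen : IsOpen D
  conj_mem : ∀ z ∈ D, conj z ∈ D
  subset : ∀ x ∈ S, (x : ℂ) ∈ D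
  holomorphic : DifferentiableOn ℂ ε D
  eq_on : ∀ x ∈ S, ε x = ε₂ x
  map_conj : ∀ z ∈ D, ε (conj z) = conj (ε z)

section Nonlinear

variable {V : Type*} [NormedAddCommGroup V] [NormedSpace ℂ V]
variable {Y : Type*} [NormedAddCommGroup Y] [NormedSpace ℂ Y]

/-- `x₀, …, x_{m-1}` is a Jordan chain of the operator function `T` at `ω`: `x₀ ≠ 0` and
`∑_{i ≤ j} (1 / i!) T⁽ⁱ⁾(ω) x_{j-i} = 0` for all `j < m`. -/
def IsJordanChain (T : ℂ → V →L[ℂ] Y) (ω : ℂ) (m : ℕ) (x : ℕ → V) : Prop :=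
  x 0 ≠ 0 ∧ ∀ j < m,
    ∑ i ∈ Finset.range (j + 1), ((Nat.factorial i : ℂ)⁻¹) • iteratedDeriv i T ω (x (j - i)) = 0

/-- The eigenvalue `ω` of the operator function `T` is simple (geometric and algebraic
multiplicity one): `ker T(ω)` is one-dimensional and all Jordan chains have length at most one. -/
def IsSimpleEigenvalue (T : ℂ → V →L[ℂ] Y) (ω : ℂ) : Prop :=
  Module.finrank ℂ (T ω).ker = 1 ∧ ∀ m x, IsJordanChain T ω m x → m ≤ 1

/-- The Jacobian at `(u, ω)` of `(u, ω) ↦ (T(ω) u, P u - 1)`, i.e. the bordered operator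
`(s, ν) ↦ (T(ω) s + ν T'(ω) u, P s)`. -/
def jacobian (T : ℂ → V →L[ℂ] Y) (P : V →L[ℂ] ℂ) (z : V × ℂ) : V × ℂ →L[ℂ] Y × ℂ :=
  ((T z.2).coprod (ContinuousLinearMap.toSpanSingleton ℂ (deriv T z.2 z.1))).prod
    (P.comp (ContinuousLinearMap.fst ℂ V ℂ))

/-- `z'` arises from `z` by one step of the bordered Newton iteration. -/
def IsNewtonStep (T : ℂ → V →L[ℂ] Y) (P : V →L[ℂ] ℂ) (z z' : V × ℂ) : Prop :=
  jacobian T P z (z' - z) = -(T z.2 z.1, 0)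

/-- The norm `(‖u‖² + |ω|²)^(1/2)` of `V × ℂ`. -/
def wNorm (z : V × ℂ) : ℝ := Real.sqrt (‖z.1‖ ^ 2 + ‖z.2‖ ^ 2)

/-- Local quadratic convergence of the bordered Newton iteration to the pair `zs = (us, ωs)`, for
normalised starting values `(u⁰, ω⁰)` that satisfy `P T(ω⁰)⁻¹ T'(ω⁰) u⁰ ≠ 0` if `ω⁰ ≠ ωs`; the
domain of the operator function `T` is `D`. -/
def NewtonConvergesLocally (T : ℂ → V →L[ℂ] Y) (D : Set ℂ) (P : V →L[ℂ] ℂ) (zs : V × ℂ) : Prop :=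
  ∃ δ : ℝ, 0 < δ ∧ ∃ C : ℝ,
    (∀ ω : ℂ, ‖ω - zs.2‖ < δ → ω ∈ D ∧ (ω ≠ zs.2 → (T ω).IsInvertible)) ∧
    ∀ z₀ : V × ℂ, wNorm (z₀ - zs) < δ → P z₀.1 = 1 →
      (z₀.2 ≠ zs.2 → P ((T z₀.2).inverse (deriv T z₀.2 z₀.1)) ≠ 0) →
      ∃ z : ℕ → V × ℂ,
        z 0 = z₀ ∧
        (∀ j, (z j).2 ∈ D ∧ (jacobian T P (z j)).IsInvertible ∧ IsNewtonStep T P (z j) (z (j + 1)))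
        ∧ (∀ j, P (z j).1 = 1) ∧
        Tendsto (fun j => wNorm (z j - zs)) atTop (𝓝 0) ∧
        ∀ j, wNorm (z (j + 1) - zs) ≤ C * wNorm (z j - zs) ^ 2

end Nonlinear

end

end PhotonicNewton

/-!
The bordered Newton iteration is Newton's method for `(u, ω) ↦ (T(ω) u, P u - 1)`, so it converges
locally quadratically as soon as the Jacobian at the normalised eigenpair `(û, ω*)` is invertible.
This follows from two facts.

* The Jacobian is injective (`jacobian_injective_of_isSimpleEigenvalue`). If `T(ω*) s + ν T'(ω*) û`
  and `P s` vanish, then `ν ≠ 0` would make `û, ν⁻¹ s` a Jordan chain of length two; so `ν = 0`, and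
  `s` is an eigenvector with `P s = 0`, hence zero since the kernel is spanned by `û`.
* The Jacobian is a compact perturbation of an invertible operator
  (`jacobian_isInvertible_of_isSimpleEigenvalue`), so the Fredholm alternative applies. The form of
  `A` becomes coercive after adding a multiple of the `L²` product
  (`opA_add_mass_isInvertible`), and all mass terms are compact because the embedding
  `H¹_per(Ω) → L²(Ω)` is (`isCompactOperator_value`).

Compactness of the embedding is proved with Fourier series for an arbitrary fundamental domain `Ω`.
The characters of the plane modulo `Λ` are periodic test functions, so the weak gradient multiplies
Fourier coefficients by the frequencies, which tend to infinity
(`isCompactOperator_of_weighted_coefficients`). The characters form an orthogonal basis of `L²(Ω)`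
(`exists_hilbertBasis_latticeChar`): trigonometric polynomials are dense in `L²` of the torus for the
image of the Lebesgue measure on `Ω`, and every measurable subset of `Ω` is, up to a null set, the
preimage of a measurable subset of the torus.

The inverse of `T(ω)` for `ω ≠ ω*` near `ω*` comes from the same Jacobian
(`eventually_isInvertible_of_jacobian`): bordering `T(ω)` by the difference quotient
`(ω - ω*)⁻¹ T(ω) û` gives an operator that tends to the Jacobian, and an operator
bordered by a column in its range must itself be invertible if the bordered operator is. Near the
solution every Jacobian is invertible, with a uniform bound on the inverses, and the iteration is
well defined for each normalised starting point.

The holomorphic extension of `ε₂` is glued from the complex sums of its real power series by the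
identity theorem (`exists_isHolomorphicExtension`).
-/

namespace PhotonicNewton

/-! ### Local convergence of the bordered Newton iteration -/

lemma norm_le_wNorm {V : Type*} [NormedAddCommGroup V] (z : V × ℂ) : ‖z‖ ≤ wNorm z := by
  rw [Prod.norm_def, wNorm]
  refine max_le (Real.le_sqrt_of_sq_le ?_) (Real.le_sqrt_of_sq_le ?_)
  · nlinarith [sq_nonneg ‖z.2‖]
  · nlinarith [sq_nonneg ‖z.1‖]

lemma wNorm_le_two_mul_norm {V : Type*} [NormedAddCommGroup V] (z : V × ℂ) : wNorm z ≤ 2 * ‖z‖ := by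
  refine Real.sqrt_le_iff.mpr ⟨by positivity, ?_⟩
  have h1 := pow_le_pow_left₀ (norm_nonneg _) (norm_fst_le z) 2
  have h2 := pow_le_pow_left₀ (norm_nonneg _) (norm_snd_le z) 2
  nlinarith [sq_nonneg ‖z‖]

section Abstract

variable {V Y : Type*} [NormedAddCommGroup V] [NormedSpace ℂ V]
  [NormedAddCommGroup Y] [NormedSpace ℂ Y]

/-- A bounded operator near an invertible one is invertible, and the inverses are bounded. -/
lemma eventually_isInvertible_and_norm_inverse_le {X : Type*} [TopologicalSpace X]
    [CompleteSpace V] {J : X → V →L[ℂ] Y} {x₀ : X}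
    (hJ : ContinuousAt J x₀) (h₀ : (J x₀).IsInvertible) :
    ∃ K : ℝ, 0 < K ∧ ∀ᶠ x in 𝓝 x₀, (J x).IsInvertible ∧ ‖(J x).inverse‖ ≤ K := by
  obtain ⟨e, he⟩ := h₀
  have hcont : ContinuousAt (ContinuousLinearMap.inverse : (V →L[ℂ] Y) → (Y →L[ℂ] V)) (J x₀) := by
    rw [← he]
    exact (contDiffAt_map_inverse (n := 0) e).continuousAt
  have hc : ContinuousAt (fun x => ‖(J x).inverse‖) x₀ :=
    (ContinuousAt.comp (g := ContinuousLinearMap.inverse) hcont hJ).norm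
  refine ⟨‖(J x₀).inverse‖ + 1, by positivity, ?_⟩
  have h1 : ∀ᶠ x in 𝓝 x₀, J x ∈ Set.range ((↑) : (V ≃L[ℂ] Y) → V →L[ℂ] Y) :=
    hJ (he ▸ ContinuousLinearEquiv.nhds e)
  filter_upwards [h1, hc.eventually_le_const (lt_add_one _)] with x hx hx'
  exact ⟨hx, hx'⟩

lemma jacobian_apply (T : ℂ → V →L[ℂ] Y) (P : V →L[ℂ] ℂ) (z w : V × ℂ) :
    jacobian T P z w = (T z.2 w.1 + w.2 • deriv T z.2 z.1, P w.1) := rfl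

/-- The operator `A` bordered by the column `b` and the row `P`. -/
noncomputable def bordered (A : V →L[ℂ] Y) (b : Y) (P : V →L[ℂ] ℂ) : V × ℂ →L[ℂ] Y × ℂ :=
  (A.coprod (ContinuousLinearMap.toSpanSingleton ℂ b)).prod
    (P.comp (ContinuousLinearMap.fst ℂ V ℂ))

lemma bordered_apply (A : V →L[ℂ] Y) (b : Y) (P : V →L[ℂ] ℂ) (w : V × ℂ) :
    bordered A b P w = (A w.1 + w.2 • b, P w.1) := rfl

lemma jacobian_eq_bordered (T : ℂ → V →L[ℂ] Y) (P : V →L[ℂ] ℂ) (z : V × ℂ) :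
    jacobian T P z = bordered (T z.2) (deriv T z.2 z.1) P := rfl

lemma continuousAt_bordered {X : Type*} [TopologicalSpace X] {A : X → V →L[ℂ] Y} {b : X → Y}
    (P : V →L[ℂ] ℂ) {x₀ : X} (hA : ContinuousAt A x₀) (hb : ContinuousAt b x₀) :
    ContinuousAt (fun x => bordered (A x) (b x) P) x₀ := by
  have h : (fun x => bordered (A x) (b x) P) = fun x =>
      (ContinuousLinearMap.inl ℂ Y ℂ).comp ((A x).comp (ContinuousLinearMap.fst ℂ V ℂ))
      + (ContinuousLinearMap.inl ℂ Y ℂ).comp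
        ((ContinuousLinearMap.toSpanSingletonCLE (𝕜 := ℂ) (b x)).comp (ContinuousLinearMap.snd ℂ V ℂ))
      + (ContinuousLinearMap.inr ℂ Y ℂ).comp (P.comp (ContinuousLinearMap.fst ℂ V ℂ)) := by
    funext x
    refine ContinuousLinearMap.ext fun w => ?_
    simp [bordered_apply]
  rw [h]
  fun_prop

/-- If bordering `A` by the column `c⁻¹ • A u` and a functional `P` with `P u = 1` gives an
invertible operator, then `A` is invertible: the column is in the range of `A`, and every vector
is of the form `s + c • u` with `P s = 0`. -/
lemma isInvertible_of_bordered [CompleteSpace V] [CompleteSpace Y] {A : V →L[ℂ] Y}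
    {P : V →L[ℂ] ℂ} {u : V} {b : Y} {c : ℂ} (hc : c ≠ 0) (hb : c • b = A u) (hu : P u = 1)
    (h : (bordered A b P).IsInvertible) : A.IsInvertible := by
  have hb' : b = c⁻¹ • A u := by rw [← hb, smul_smul, inv_mul_cancel₀ hc, one_smul]
  have hinj : Function.Injective A := by
    rw [injective_iff_map_eq_zero]
    intro w hw
    have h0 : bordered A b P (w - P w • u, c * P w) = 0 := by
      rw [bordered_apply]
      simp only [map_sub, map_smul, hw, hb', hu, smul_smul, smul_eq_mul, mul_one, sub_self, zero_sub]
      rw [mul_comm c, mul_assoc, mul_inv_cancel₀ hc, mul_one, neg_add_cancel]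
      rfl
    have h1 := h.injective (h0.trans (map_zero _).symm)
    rw [Prod.ext_iff] at h1
    have h2 : P w = 0 := by simpa [hc] using h1.2
    simpa [h2] using h1.1
  have hsurj : Function.Surjective A := by
    intro y
    obtain ⟨w, hw⟩ := h.surjective (y, 0)
    rw [bordered_apply, Prod.ext_iff] at hw
    refine ⟨w.1 + (w.2 * c⁻¹) • u, ?_⟩
    have h1 : A w.1 + w.2 • b = y := hw.1
    rw [map_add, map_smul, ← h1, hb', smul_smul]
  exact ⟨ContinuousLinearEquiv.ofBijective A (LinearMap.ker_eq_bot.mpr hinj)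
    (LinearMap.range_eq_top.mpr hsurj), rfl⟩

/-- If the bordered Jacobian at a normalised eigenpair `(u, ω₀)` is invertible, then `ω₀` is an
isolated eigenvalue: bordering `T(ω)` by the difference quotient of `T(·) u`, which depends
continuously on `ω`, gives the Jacobian at `ω = ω₀`. -/
lemma eventually_isInvertible_of_jacobian [CompleteSpace V] [CompleteSpace Y]
    {T : ℂ → V →L[ℂ] Y} {ω₀ : ℂ}
    (hT : AnalyticAt ℂ T ω₀) {P : V →L[ℂ] ℂ} {u : V} (hu : T ω₀ u = 0) (hP : P u = 1)
    (hJ : (jacobian T P (u, ω₀)).IsInvertible) :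
    ∀ᶠ ω in 𝓝 ω₀, ω ≠ ω₀ → (T ω).IsInvertible := by
  have hcont : ContinuousAt (fun ω => dslope T ω₀ ω u) ω₀ :=
    (continuousAt_dslope_same.mpr hT.differentiableAt).clm_apply continuousAt_const
  have hb := continuousAt_bordered P hT.continuousAt hcont
  obtain ⟨K, -, hK⟩ := eventually_isInvertible_and_norm_inverse_le hb
    (by simpa only [dslope_same, jacobian_eq_bordered] using hJ)
  filter_upwards [hK] with ω hω hne
  refine isInvertible_of_bordered (sub_ne_zero.mpr hne) ?_ hP hω.1
  rw [← smul_apply, sub_smul_dslope, sub_apply, hu, sub_zero]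

/-- The linearisation error of `ω ↦ T(ω)` at `ω₀`, with the derivative taken at the far end point,
is quadratic. -/
lemma exists_norm_sub_smul_deriv_le {T : ℂ → V →L[ℂ] Y} [CompleteSpace Y] {ω₀ : ℂ}
    (hT : AnalyticAt ℂ T ω₀) :
    ∃ Q : ℝ, 0 < Q ∧ ∀ᶠ ω in 𝓝 ω₀,
      ‖(ω - ω₀) • deriv T ω - (T ω - T ω₀)‖ ≤ Q * ‖ω - ω₀‖ ^ 2 := by
  have h1 : AnalyticAt ℂ (dslope T ω₀) ω₀ := by
    obtain ⟨p, hp⟩ := hT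
    exact ⟨_, hp.has_fpower_series_dslope_fslope⟩
  have h2 : DifferentiableAt ℂ (fun ω => deriv T ω - dslope T ω₀ ω) ω₀ :=
    hT.deriv.differentiableAt.sub h1.differentiableAt
  obtain ⟨Q, hQ, hb⟩ := h2.isBigO_sub.exists_pos
  refine ⟨Q, hQ, ?_⟩
  filter_upwards [hb.bound] with ω hω
  rw [← sub_smul_dslope, ← smul_sub, norm_smul, pow_two]
  simp only [dslope_same, sub_self, sub_zero] at hω
  calc ‖ω - ω₀‖ * ‖deriv T ω - dslope T ω₀ ω‖ ≤ ‖ω - ω₀‖ * (Q * ‖ω - ω₀‖) := by gcongr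
    _ = Q * (‖ω - ω₀‖ * ‖ω - ω₀‖) := by ring

/-- One Newton step from a normalised point near a solution with invertible Jacobian reduces the
error quadratically. -/
lemma exists_newton_step_bound [CompleteSpace V] [CompleteSpace Y] {T : ℂ → V →L[ℂ] Y} {ω₀ : ℂ}
    (hT : AnalyticAt ℂ T ω₀) {P : V →L[ℂ] ℂ} {u : V} (hu : T ω₀ u = 0) (hP : P u = 1)
    (hJ : (jacobian T P (u, ω₀)).IsInvertible) :
    ∃ C : ℝ, 0 < C ∧ ∀ᶠ z in 𝓝 (u, ω₀), (jacobian T P z).IsInvertible ∧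
      (P z.1 = 1 →
        ‖z - (jacobian T P z).inverse (T z.2 z.1, 0) - (u, ω₀)‖ ≤ C * ‖z - (u, ω₀)‖ ^ 2) := by
  have hsnd : Tendsto Prod.snd (𝓝 (u, ω₀)) (𝓝 ω₀) := continuous_snd.continuousAt
  have hJc : ContinuousAt (jacobian T P) (u, ω₀) := by
    have hd : ContinuousAt (fun z : V × ℂ => deriv T z.2 z.1) (u, ω₀) :=
      (ContinuousAt.comp (g := deriv T) (f := Prod.snd) hT.deriv.continuousAt
        continuousAt_snd).clm_apply continuousAt_fst
    exact continuousAt_bordered P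
      (ContinuousAt.comp (g := T) (f := Prod.snd) hT.continuousAt continuousAt_snd) hd
  obtain ⟨K, hK, hinv⟩ := eventually_isInvertible_and_norm_inverse_le hJc hJ
  obtain ⟨Q, hQ, hquad⟩ := exists_norm_sub_smul_deriv_le hT
  have hM := hT.deriv.continuousAt.norm.eventually_le_const (lt_add_one ‖deriv T ω₀‖)
  set M := ‖deriv T ω₀‖ + 1 with hMdef
  have hMpos : 0 < M := by positivity
  refine ⟨K * (M + Q * ‖u‖), by positivity, ?_⟩
  filter_upwards [hinv, hsnd.eventually hquad, hsnd.eventually hM] with z hz hzQ hzM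
  refine ⟨hz.1, fun hPz => ?_⟩
  obtain ⟨v, ω⟩ := z
  simp only at hz hzQ hzM hPz ⊢
  set J := jacobian T P (v, ω)
  set n := ‖(v, ω) - (u, ω₀)‖
  have hn1 : ‖v - u‖ ≤ n := norm_fst_le ((v, ω) - (u, ω₀))
  have hn2 : ‖ω - ω₀‖ ≤ n := norm_snd_le ((v, ω) - (u, ω₀))
  have hres : J ((v, ω) - (u, ω₀)) - (T ω v, 0)
      = ((ω - ω₀) • deriv T ω (v - u) + ((ω - ω₀) • deriv T ω - (T ω - T ω₀)) u, 0) := by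
    rw [jacobian_apply]
    simp [hPz, hP, hu, smul_sub]
    abel
  -- The new error is the inverse Jacobian applied to the linearisation error `hres`.
  have heq : (v, ω) - J.inverse (T ω v, 0) - (u, ω₀)
      = J.inverse (J ((v, ω) - (u, ω₀)) - (T ω v, 0)) := by
    rw [map_sub, hz.1.inverse_apply_self]
    abel
  have hnn : 0 ≤ n := norm_nonneg _
  have hR : ‖J ((v, ω) - (u, ω₀)) - (T ω v, 0)‖ ≤ (M + Q * ‖u‖) * n ^ 2 := by
    rw [hres, Prod.norm_mk, norm_zero, max_eq_left (norm_nonneg _)]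
    calc _ ≤ ‖(ω - ω₀) • deriv T ω (v - u)‖ + ‖((ω - ω₀) • deriv T ω - (T ω - T ω₀)) u‖ :=
          norm_add_le _ _
      _ ≤ n * (M * n) + (Q * n ^ 2) * ‖u‖ := by
          refine add_le_add ?_ ?_
          · rw [norm_smul]
            refine mul_le_mul hn2 (((deriv T ω).le_opNorm _).trans ?_) (norm_nonneg _) hnn
            gcongr
          · refine (ContinuousLinearMap.le_opNorm _ _).trans ?_
            refine mul_le_mul_of_nonneg_right (hzQ.trans ?_) (norm_nonneg _)
            gcongr
      _ = _ := by ring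
  rw [heq]
  calc _ ≤ ‖J.inverse‖ * ‖J ((v, ω) - (u, ω₀)) - (T ω v, 0)‖ := J.inverse.le_opNorm _
    _ ≤ K * ((M + Q * ‖u‖) * n ^ 2) := by
        gcongr
        exact hz.2
    _ = _ := by ring

/-- Newton's method for a nonlinear eigenvalue problem converges locally quadratically as soon as
the bordered Jacobian at the normalised eigenpair is invertible. -/
theorem newtonConvergesLocally_of_jacobian_isInvertible [CompleteSpace V] [CompleteSpace Y]
    {T : ℂ → V →L[ℂ] Y} {D : Set ℂ} {ω₀ : ℂ} (hD : D ∈ 𝓝 ω₀) (hT : AnalyticAt ℂ T ω₀)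
    {P : V →L[ℂ] ℂ} {u : V} (hu : T ω₀ u = 0) (hP : P u = 1)
    (hJ : (jacobian T P (u, ω₀)).IsInvertible) :
    NewtonConvergesLocally T D P (u, ω₀) := by
  obtain ⟨C, hC, hstep⟩ := exists_newton_step_bound hT hu hP hJ
  obtain ⟨r, hr, hball⟩ := Metric.eventually_nhds_iff.mp hstep
  obtain ⟨r', hr', hball'⟩ := Metric.eventually_nhds_iff.mp
    ((eventually_mem_set.mpr hD).and (eventually_isInvertible_of_jacobian hT hu hP hJ))
  -- Below the radius `(4C)⁻¹` the quadratic bound halves the error.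
  set δ := min (min r r') (4 * C)⁻¹ with hδ
  have hδr : δ ≤ r := (min_le_left _ _).trans (min_le_left _ _)
  have hδr' : δ ≤ r' := (min_le_left _ _).trans (min_le_right _ _)
  have hδC : δ ≤ (4 * C)⁻¹ := min_le_right _ _
  refine ⟨δ, by positivity, 2 * C, fun ω hω => ?_, fun z₀ hz₀ hPz₀ _ => ?_⟩
  · exact hball' (by rw [dist_eq_norm]; exact hω.trans_le hδr')
  set zs : V × ℂ := (u, ω₀)
  set N : V × ℂ → V × ℂ := fun z => z - (jacobian T P z).inverse (T z.2 z.1, 0) with hN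
  have key : ∀ z, wNorm (z - zs) < δ → P z.1 = 1 →
      z.2 ∈ D ∧ (jacobian T P z).IsInvertible ∧ IsNewtonStep T P z (N z) ∧ P (N z).1 = 1 ∧
      wNorm (N z - zs) ≤ 2 * C * wNorm (z - zs) ^ 2 ∧
      wNorm (N z - zs) ≤ 2⁻¹ * wNorm (z - zs) := by
    intro z hz hPz
    have hzn := norm_le_wNorm (z - zs)
    have hz0 : 0 ≤ wNorm (z - zs) := Real.sqrt_nonneg _
    obtain ⟨hi, hb⟩ := hball (y := z) (by rw [dist_eq_norm]; exact (hzn.trans_lt hz).trans_le hδr)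
    have hnewt : IsNewtonStep T P z (N z) := by
      rw [IsNewtonStep, hN, sub_sub_cancel_left, map_neg, hi.self_apply_inverse]
    have hquad : wNorm (N z - zs) ≤ 2 * C * wNorm (z - zs) ^ 2 :=
      calc _ ≤ 2 * ‖N z - zs‖ := wNorm_le_two_mul_norm _
        _ ≤ 2 * (C * ‖z - zs‖ ^ 2) := by gcongr; exact hb hPz
        _ ≤ 2 * (C * wNorm (z - zs) ^ 2) := by gcongr
        _ = _ := by ring
    refine ⟨(hball' (y := z.2) ?_).1, hi, hnewt, ?_, hquad, hquad.trans ?_⟩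
    · rw [dist_eq_norm]
      exact ((norm_snd_le (z - zs)).trans_lt (hzn.trans_lt hz)).trans_le hδr'
    · have h2 := congrArg Prod.snd hnewt
      rw [jacobian_apply] at h2
      simpa [sub_eq_zero, hPz] using h2
    · have h3 : C * wNorm (z - zs) ≤ 4⁻¹ :=
        calc _ ≤ C * (4 * C)⁻¹ := by gcongr; exact hz.le.trans hδC
          _ = 4⁻¹ := by field_simp
      nlinarith
  have inv : ∀ j, wNorm (N^[j] z₀ - zs) ≤ 2⁻¹ ^ j * wNorm (z₀ - zs) ∧
      wNorm (N^[j] z₀ - zs) < δ ∧ P (N^[j] z₀).1 = 1 := by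
    intro j
    induction j with
    | zero => exact ⟨by simp, hz₀, hPz₀⟩
    | succ j ih =>
      obtain ⟨-, -, -, h4, -, h6⟩ := key _ ih.2.1 ih.2.2
      rw [Function.iterate_succ_apply']
      have h0 : 0 ≤ wNorm (N^[j] z₀ - zs) := Real.sqrt_nonneg _
      refine ⟨h6.trans ?_, by linarith [ih.2.1], h4⟩
      rw [pow_succ']
      linarith [ih.1]
  refine ⟨fun j => N^[j] z₀, rfl, fun j => ?_, fun j => (inv j).2.2, ?_, fun j => ?_⟩
  · obtain ⟨h1, h2, h3, -⟩ := key _ (inv j).2.1 (inv j).2.2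
    refine ⟨h1, h2, ?_⟩
    simp only [Function.iterate_succ_apply']
    exact h3
  · refine squeeze_zero (fun j => Real.sqrt_nonneg _) (fun j => (inv j).1) ?_
    simpa using (tendsto_pow_atTop_nhds_zero_of_lt_one (r := (2⁻¹ : ℝ)) (by norm_num)
      (by norm_num)).mul_const (wNorm (z₀ - zs))
  · simp only [Function.iterate_succ_apply']
    exact (key _ (inv j).2.1 (inv j).2.2).2.2.2.2.1

/-- At a normalised eigenpair with simple eigenvalue the bordered Jacobian is injective: a
nontrivial kernel element would either be a Jordan chain of length two or an eigenvector `s`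
with `P s = 0`. -/
lemma jacobian_injective_of_isSimpleEigenvalue {T : ℂ → V →L[ℂ] Y} {ω₀ : ℂ}
    (hsimple : IsSimpleEigenvalue T ω₀) {P : V →L[ℂ] ℂ} {u : V} (hu : T ω₀ u = 0) (hP : P u = 1) :
    Function.Injective (jacobian T P (u, ω₀)) := by
  have hu0 : u ≠ 0 := by rintro rfl; simp at hP
  rw [injective_iff_map_eq_zero]
  rintro ⟨s, ν⟩ hs
  rw [jacobian_apply, Prod.ext_iff] at hs
  simp only [Prod.fst_zero, Prod.snd_zero] at hs
  obtain ⟨hs1, hs2⟩ := hs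
  have hν : ν = 0 := by
    by_contra hν
    have hchain : IsJordanChain T ω₀ 2 (fun i => if i = 0 then u else ν⁻¹ • s) := by
      refine ⟨by simpa using hu0, fun j hj => ?_⟩
      interval_cases j
      · simp [hu]
      · have : ν⁻¹ • (T ω₀ s + ν • deriv T ω₀ u) = 0 := by rw [hs1, smul_zero]
        rw [smul_add, smul_smul, inv_mul_cancel₀ hν, one_smul] at this
        simpa [Finset.sum_range_succ] using this
    exact absurd (hsimple.2 2 _ hchain) (by norm_num)
  subst hν
  rw [zero_smul, add_zero] at hs1
  obtain ⟨c, hc⟩ := exists_smul_eq_of_finrank_eq_one hsimple.1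
    (x := (⟨u, hu⟩ : (T ω₀).ker)) (by simpa [Subtype.ext_iff] using hu0) ⟨s, hs1⟩
  have hc' : c • u = s := congrArg Subtype.val hc
  have : c = 0 := by simpa [← hc', hP] using hs2
  simp [← hc', this]

/-- The Fredholm alternative: an injective compact perturbation of an invertible operator is
invertible. -/
lemma isInvertible_sub_of_isCompactOperator [CompleteSpace V] [CompleteSpace Y]
    {L K : V →L[ℂ] Y} (hL : L.IsInvertible) (hK : IsCompactOperator K)
    (hinj : Function.Injective (L - K)) : (L - K).IsInvertible := by
  obtain ⟨e, rfl⟩ := hL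
  set C : V →L[ℂ] V := (e.symm : Y →L[ℂ] V).comp K
  have hC : IsCompactOperator C := hK.clm_comp (e.symm : Y →L[ℂ] V)
  have hfac : (e : V →L[ℂ] Y) - K = (e : V →L[ℂ] Y).comp (1 - C) := by
    ext x
    simp [C]
  rcases hC.hasEigenvalue_or_mem_resolventSet one_ne_zero with h | h
  · obtain ⟨v, hv⟩ := h.exists_hasEigenvector
    have hv1 : C v = v := by simpa using hv.apply_eq_smul
    refine absurd (hinj (a₁ := v) (a₂ := 0) ?_) hv.2
    rw [hfac]
    simp [hv1]
  · rw [spectrum.mem_resolventSet_iff, map_one, ContinuousLinearMap.isUnit_iff_bijective] at h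
    rw [hfac, ContinuousLinearMap.isInvertible_equiv_comp]
    exact ⟨ContinuousLinearEquiv.ofBijective (1 - C) (LinearMap.ker_eq_bot.mpr h.1)
      (LinearMap.range_eq_top.mpr h.2), rfl⟩

/-- If `T(ω₀)` is a compact perturbation of an invertible operator, then simplicity of the
eigenvalue `ω₀` makes the bordered Jacobian invertible. -/
lemma jacobian_isInvertible_of_isSimpleEigenvalue [CompleteSpace V] [CompleteSpace Y]
    {T : ℂ → V →L[ℂ] Y} {ω₀ : ℂ}
    (hsimple : IsSimpleEigenvalue T ω₀) {P : V →L[ℂ] ℂ} {u : V} (hu : T ω₀ u = 0) (hP : P u = 1)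
    {L K : V →L[ℂ] Y} (hL : L.IsInvertible) (hK : IsCompactOperator K) (hT : T ω₀ = L - K) :
    (jacobian T P (u, ω₀)).IsInvertible := by
  obtain ⟨e, rfl⟩ := hL
  set L' : V × ℂ →L[ℂ] Y × ℂ := (e : V →L[ℂ] Y).prodMap (ContinuousLinearMap.id ℂ ℂ)
  have hL' : L'.IsInvertible := ⟨e.prodCongr (ContinuousLinearEquiv.refl ℂ ℂ), rfl⟩
  set K' : V × ℂ →L[ℂ] Y × ℂ := L' - jacobian T P (u, ω₀) with hK'
  -- `K'` is the sum of `K` and operators that factor through `ℂ`.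
  have hK'c : IsCompactOperator K' := by
    have hdec : K' = (ContinuousLinearMap.inl ℂ Y ℂ).comp (K.comp (ContinuousLinearMap.fst ℂ V ℂ))
        + ((ContinuousLinearMap.inr ℂ Y ℂ - (ContinuousLinearMap.inl ℂ Y ℂ).comp
            (ContinuousLinearMap.toSpanSingleton ℂ (deriv T ω₀ u))).comp
              (ContinuousLinearMap.snd ℂ V ℂ)
          - (ContinuousLinearMap.inr ℂ Y ℂ).comp (P.comp (ContinuousLinearMap.fst ℂ V ℂ))) := by
      refine ContinuousLinearMap.ext fun w => ?_
      simp only [hK', L', sub_apply, jacobian_apply, hT]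
      ext <;> simp; abel
    rw [hdec]
    have h1 : IsCompactOperator
        ((ContinuousLinearMap.inl ℂ Y ℂ).comp (K.comp (ContinuousLinearMap.fst ℂ V ℂ))) :=
      (hK.comp_clm (ContinuousLinearMap.fst ℂ V ℂ)).clm_comp (ContinuousLinearMap.inl ℂ Y ℂ)
    have h2 : IsCompactOperator ((ContinuousLinearMap.inr ℂ Y ℂ
        - (ContinuousLinearMap.inl ℂ Y ℂ).comp
            (ContinuousLinearMap.toSpanSingleton ℂ (deriv T ω₀ u))).comp
              (ContinuousLinearMap.snd ℂ V ℂ)) :=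
      (isCompactOperator_of_locallyCompactSpace_rng
        (ContinuousLinearMap.inr ℂ Y ℂ - (ContinuousLinearMap.inl ℂ Y ℂ).comp
            (ContinuousLinearMap.toSpanSingleton ℂ (deriv T ω₀ u)))).comp_clm
        (ContinuousLinearMap.snd ℂ V ℂ)
    have h3 : IsCompactOperator
        ((ContinuousLinearMap.inr ℂ Y ℂ).comp (P.comp (ContinuousLinearMap.fst ℂ V ℂ))) :=
      (isCompactOperator_of_locallyCompactSpace_rng (ContinuousLinearMap.inr ℂ Y ℂ)).comp_clm
        (P.comp (ContinuousLinearMap.fst ℂ V ℂ))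
    exact h1.add (h2.sub h3)
  have hJ : jacobian T P (u, ω₀) = L' - K' := by rw [hK', sub_sub_cancel]
  rw [hJ]
  refine isInvertible_sub_of_isCompactOperator hL' hK'c ?_
  rw [← hJ]
  exact jacobian_injective_of_isSimpleEigenvalue hsimple hu hP

/-- The bordered Newton iteration converges locally quadratically to a normalised eigenpair of an
analytic operator function if the eigenvalue is simple and `T(ω₀)` is a compact perturbation of an
invertible operator. -/
theorem newtonConvergesLocally_of_isSimpleEigenvalue [CompleteSpace V] [CompleteSpace Y]
    {T : ℂ → V →L[ℂ] Y} {D : Set ℂ} {ω₀ : ℂ} (hD : D ∈ 𝓝 ω₀) (hT : AnalyticAt ℂ T ω₀)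
    {u : V} (hu : T ω₀ u = 0) (hsimple : IsSimpleEigenvalue T ω₀)
    {P : V →L[ℂ] ℂ} (hP : P u ≠ 0)
    {L K : V →L[ℂ] Y} (hL : L.IsInvertible) (hK : IsCompactOperator K) (hTLK : T ω₀ = L - K) :
    NewtonConvergesLocally T D P ((P u)⁻¹ • u, ω₀) := by
  have hu1 : T ω₀ ((P u)⁻¹ • u) = 0 := by rw [map_smul, hu, smul_zero]
  have hP1 : P ((P u)⁻¹ • u) = 1 := by rw [map_smul, smul_eq_mul, inv_mul_cancel₀ hP]
  exact newtonConvergesLocally_of_jacobian_isInvertible hD hT hu1 hP1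
    (jacobian_isInvertible_of_isSimpleEigenvalue hsimple hu1 hP1 hL hK hTLK)

end Abstract

/-! ### Coercivity of the shifted form -/

section Coercive

variable {V : Type*} [NormedAddCommGroup V] [InnerProductSpace ℂ V]

/-- The Riesz representation theorem for the conjugate dual. -/
lemma pullbackForm_id_isInvertible [CompleteSpace V] :
    (pullbackForm (ContinuousLinearMap.id ℂ V)).IsInvertible := by
  have hinj : Function.Injective (pullbackForm (ContinuousLinearMap.id ℂ V)) := by
    intro u w h
    refine ext_inner_left ℂ fun v => ?_
    simpa [pullbackForm_apply] using congrArg (fun φ : ConjDual V => φ v) h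
  have hsurj : Function.Surjective (pullbackForm (ContinuousLinearMap.id ℂ V)) := by
    intro φ
    let ψ : V →L[ℂ] ℂ := ((starL ℂ : ℂ ≃L⋆[ℂ] ℂ) : ℂ →L⋆[ℂ] ℂ).comp φ
    refine ⟨(InnerProductSpace.toDual ℂ V).symm ψ, ContinuousLinearMap.ext fun v => ?_⟩
    have h : inner ℂ ((InnerProductSpace.toDual ℂ V).symm ψ) v = conj (φ v) :=
      InnerProductSpace.toDual_symm_apply
    rw [pullbackForm_apply, ContinuousLinearMap.id_apply, ContinuousLinearMap.id_apply,
      ← inner_conj_symm, h, Complex.conj_conj]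
  exact ⟨ContinuousLinearEquiv.ofBijective _ (LinearMap.ker_eq_bot.mpr hinj)
    (LinearMap.range_eq_top.mpr hsurj), rfl⟩

/-- The Lax–Milgram lemma for complex Hilbert spaces. -/
lemma isInvertible_of_coercive [CompleteSpace V] (L : V →L[ℂ] ConjDual V) {m : ℝ} (hm : 0 < m)
    (h : ∀ u, m * ‖u‖ ^ 2 ≤ ‖L u u‖) : L.IsInvertible := by
  obtain ⟨R, hR⟩ := pullbackForm_id_isInvertible (V := V)
  set S : V →L[ℂ] V := (R.symm : ConjDual V →L[ℂ] V).comp L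
  have hLS : L = (R : V →L[ℂ] ConjDual V).comp S := by
    ext u
    simp [S]
  have hS : ∀ u v, inner ℂ v (S u) = L u v := by
    intro u v
    rw [hLS, hR]
    rfl
  have hunit : IsUnit S := by
    refine ContinuousLinearMap.isUnit_of_forall_le_norm_inner_map S (c := ⟨m, hm.le⟩) hm fun u => ?_
    rw [norm_inner_symm, hS, mul_comm]
    exact h u
  rw [ContinuousLinearMap.isUnit_iff_bijective] at hunit
  rw [hLS, ContinuousLinearMap.isInvertible_equiv_comp]
  exact ⟨ContinuousLinearEquiv.ofBijective S (LinearMap.ker_eq_bot.mpr hunit.1)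
    (LinearMap.range_eq_top.mpr hunit.2), rfl⟩

lemma isCompactOperator_pullbackForm {H : Type*} [NormedAddCommGroup H] [InnerProductSpace ℂ H]
    {G : V →L[ℂ] H} (hG : IsCompactOperator G) : IsCompactOperator (pullbackForm G) :=
  hG.clm_comp ((innerSL ℂ (E := H)).flip.bilinearComp (ContinuousLinearMap.id ℂ H) G)

end Coercive

section PeriodicSobolev

variable {Λ : Submodule ℤ Plane} {Ω : Set Plane}

lemma integral_mul_eq_inner (f : L2 Ω) {ψ : Plane → ℂ} (hψ : MemLp ψ 2 (volume.restrict Ω)) :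
    ∫ x in Ω, f x * ψ x = inner ℂ (hψ.star.toLp (star ψ)) f := by
  rw [L2.inner_def]
  refine integral_congr_ae ?_
  filter_upwards [hψ.star.coeFn_toLp] with x hx
  simp [hx]

lemma isClosed_periodicH1 : IsClosed (periodicH1 Λ Ω : Set (L2Jet Ω)) := by
  have h : (periodicH1 Λ Ω : Set (L2Jet Ω)) = ⋂ (φ : Plane → ℂ) (hφ : IsPeriodicTest Λ Ω φ)
      (j : Fin 2), {p | inner ℂ ((hφ.memLp_partialDeriv j).star.toLp _) p.fst
        = - inner ℂ (hφ.memLp.star.toLp _) (p.snd j)} := by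
    ext p
    simp only [Set.mem_iInter]
    refine forall_congr' fun φ => forall_congr' fun hφ => forall_congr' fun j => ?_
    rw [integral_mul_eq_inner _ (hφ.memLp_partialDeriv j), integral_mul_eq_inner _ hφ.memLp]
    rfl
  rw [h]
  refine isClosed_iInter fun φ => isClosed_iInter fun hφ => isClosed_iInter fun j =>
    isClosed_eq ?_ ?_
  · exact continuous_const.inner (WithLp.fstL 2 ℂ (L2 Ω) (PiLp 2 (fun _ : Fin 2 => L2 Ω))).continuous
  · exact (continuous_const.inner ((PiLp.proj 2 (fun _ : Fin 2 => L2 Ω) j).comp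
      (WithLp.sndL 2 ℂ (L2 Ω) (PiLp 2 (fun _ : Fin 2 => L2 Ω)))).continuous).neg

instance : CompleteSpace (H1per Λ Ω) :=
  (isClosed_periodicH1 (Λ := Λ) (Ω := Ω)).completeSpace_coe

lemma norm_sq_eq (u : H1per Λ Ω) :
    ‖u‖ ^ 2 = ‖value u‖ ^ 2 + (‖weakPartial 0 u‖ ^ 2 + ‖weakPartial 1 u‖ ^ 2) := by
  have h1 : ‖u‖ ^ 2 = ‖jet u‖ ^ 2 := rfl
  rw [h1, WithLp.prod_norm_sq_eq_of_L2, PiLp.norm_sq_eq_of_L2, Fin.sum_univ_two]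
  rfl

/-- After adding a sufficiently large multiple of the `L²` inner product, the form of `A` is
coercive. -/
lemma opA_add_mass_isInvertible (k : Plane) :
    (opA (Λ := Λ) (Ω := Ω) k
      + ((1 + k 0 ^ 2 + k 1 ^ 2 : ℝ) : ℂ) • pullbackForm value).IsInvertible := by
  refine isInvertible_of_coercive _ (m := 1 / 2) (by norm_num) fun u => ?_
  have hval : (opA k + ((1 + k 0 ^ 2 + k 1 ^ 2 : ℝ) : ℂ) • pullbackForm value :
      H1per Λ Ω →L[ℂ] ConjDual (H1per Λ Ω)) u u
      = ((‖shiftedPartial k 0 u‖ ^ 2 + ‖shiftedPartial k 1 u‖ ^ 2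
        + (1 + k 0 ^ 2 + k 1 ^ 2) * ‖value u‖ ^ 2 : ℝ) : ℂ) := by
    simp [opA, Fin.sum_univ_two, pullbackForm_apply, inner_self_eq_norm_sq_to_K]
  -- Removing the shift `i kⱼ u` from the gradient costs at most a multiple of `‖u‖²` in `L²`.
  have hj : ∀ j, ‖weakPartial j u‖ ^ 2
      ≤ 2 * ‖shiftedPartial k j u‖ ^ 2 + 2 * (k j ^ 2 * ‖value u‖ ^ 2) := by
    intro j
    have h1 : weakPartial j u = shiftedPartial k j u - (Complex.I * (k j : ℂ)) • value u := by
      simp [shiftedPartial]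
    have h2 : ‖weakPartial j u‖ ≤ ‖shiftedPartial k j u‖ + |k j| * ‖value u‖ := by
      rw [h1]
      refine (norm_sub_le _ _).trans_eq ?_
      simp [norm_smul]
    have h3 := pow_le_pow_left₀ (norm_nonneg _) h2 2
    have h4 : (|k j| * ‖value u‖) ^ 2 = k j ^ 2 * ‖value u‖ ^ 2 := by rw [mul_pow, sq_abs]
    nlinarith [sq_nonneg (‖shiftedPartial k j u‖ - |k j| * ‖value u‖)]
  rw [hval, Complex.norm_real, Real.norm_of_nonneg (by positivity), norm_sq_eq]
  nlinarith [hj 0, hj 1, sq_nonneg ‖value u‖]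

lemma isCompactOperator_opB (hval : IsCompactOperator (value (Λ := Λ) (Ω := Ω)))
    (Ω₁ Ω₂ : Set Plane) (α₁ : ℝ) (ε : ℂ → ℂ) (ω : ℂ) :
    IsCompactOperator (opB (Λ := Λ) (Ω := Ω) Ω₁ Ω₂ α₁ ε ω) := by
  have hm : ∀ Ω' : Set Plane, IsCompactOperator (massOn (Λ := Λ) (Ω := Ω) Ω') := fun Ω' =>
    isCompactOperator_pullbackForm
      (hval.clm_comp (LpToLpRestrictCLM Plane ℂ ℂ (volume.restrict Ω) 2 Ω'))
  exact (((hm Ω₁).smul (α₁ : ℂ)).add ((hm Ω₂).smul (ε ω))).smul (ω ^ 2)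

lemma differentiableOn_sub_sq_smul {E : Type*} [NormedAddCommGroup E] [NormedSpace ℂ E]
    {D : Set ℂ} {ε : ℂ → ℂ} (hε : DifferentiableOn ℂ ε D) (A M₁ M₂ : E) (a : ℂ) :
    DifferentiableOn ℂ (fun ω => A - ω ^ 2 • (a • M₁ + ε ω • M₂)) D :=
  (differentiableOn_const A).sub ((differentiableOn_id.pow 2).smul
    ((differentiableOn_const (a • M₁)).add (hε.smul_const M₂)))

lemma analyticAt_opT {D : Set ℂ} {ε : ℂ → ℂ} (hD : IsOpen D) (hε : DifferentiableOn ℂ ε D)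
    (Ω₁ Ω₂ : Set Plane) (k : Plane) (α₁ : ℝ) {ω : ℂ} (hω : ω ∈ D) :
    AnalyticAt ℂ (opT Λ Ω Ω₁ Ω₂ k α₁ ε) ω :=
  differentiableOn_sub_sq_smul hε _ _ _ _ |>.analyticAt (hD.mem_nhds hω)

/-- The bordered Newton iteration for a simple eigenvalue of `T` converges locally quadratically,
provided the embedding `H¹_per(Ω) → L²(Ω)` is compact. -/
lemma newtonConvergesLocally_opT (hval : IsCompactOperator (value (Λ := Λ) (Ω := Ω)))
    {D : Set ℂ} {ε : ℂ → ℂ} (hD : IsOpen D) (hε : DifferentiableOn ℂ ε D)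
    {Ω₁ Ω₂ : Set Plane} {k : Plane} {α₁ : ℝ} {us : H1per Λ Ω} {ωs : ℂ} (hωs : ωs ∈ D)
    (hus : opT Λ Ω Ω₁ Ω₂ k α₁ ε ωs us = 0)
    (hsimple : IsSimpleEigenvalue (opT Λ Ω Ω₁ Ω₂ k α₁ ε) ωs)
    {P : H1per Λ Ω →L[ℂ] ℂ} (hP : P us ≠ 0) :
    NewtonConvergesLocally (opT Λ Ω Ω₁ Ω₂ k α₁ ε) D P ((P us)⁻¹ • us, ωs) := by
  refine newtonConvergesLocally_of_isSimpleEigenvalue (hD.mem_nhds hωs)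
    (analyticAt_opT hD hε Ω₁ Ω₂ k α₁ hωs) hus hsimple hP
    (opA_add_mass_isInvertible k)
    (K := ((1 + k 0 ^ 2 + k 1 ^ 2 : ℝ) : ℂ) • pullbackForm value + opB Ω₁ Ω₂ α₁ ε ωs)
    (((isCompactOperator_pullbackForm hval).smul
      ((1 + k 0 ^ 2 + k 1 ^ 2 : ℝ) : ℂ)).add (isCompactOperator_opB hval Ω₁ Ω₂ α₁ ε ωs)) ?_
  rw [opT]
  abel

end PeriodicSobolev

/-! ### Holomorphic extension of real analytic functions -/

section Extension

/-- A real analytic function extends holomorphically near each point: its power series converges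
in a complex disc. -/
lemma exists_analyticAt_eventually_eq_ofReal {f : ℝ → ℝ} {x : ℝ} (hf : AnalyticAt ℝ f x) :
    ∃ F : ℂ → ℂ, AnalyticAt ℂ F x ∧ ∀ᶠ t : ℝ in 𝓝 x, F t = f t := by
  obtain ⟨p, hp⟩ := hf
  set q : FormalMultilinearSeries ℂ ℂ ℂ :=
    FormalMultilinearSeries.ofScalars ℂ (fun n => (p.coeff n : ℂ)) with hq
  have hnorm : ∀ n, ‖q n‖ = ‖p n‖ := fun n => by
    rw [hq, FormalMultilinearSeries.ofScalars_norm, Complex.norm_real, p.norm_apply_eq_norm_coef]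
  have hrad : q.radius = p.radius := by simp only [FormalMultilinearSeries.radius, hnorm]
  have hqpos : 0 < q.radius := hrad ▸ hp.radius_pos
  have hF : HasFPowerSeriesAt (fun z : ℂ => q.sum (z - x)) q x := by
    simpa using (q.hasFPowerSeriesOnBall hqpos).hasFPowerSeriesAt.comp_sub (x : ℂ)
  refine ⟨fun z => q.sum (z - x), ⟨q, hF⟩, ?_⟩
  have h1 := hasFPowerSeriesAt_iff'.mp hp
  have h2 := (Complex.continuous_ofReal.tendsto x).eventually (hasFPowerSeriesAt_iff'.mp hF)
  filter_upwards [h1, h2] with t ht1 ht2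
  refine ht2.unique ?_
  have := Complex.ofRealCLM.hasSum ht1
  simpa [Function.comp_def, hq, FormalMultilinearSeries.coeff_ofScalars] using this

/-- The identity theorem for two functions that agree on the real points of a connected set. -/
lemma eqOn_of_eq_on_reals {F G : ℂ → ℂ} {U : Set ℂ} (hU : IsOpen U) (hc : IsPreconnected U)
    (hF : AnalyticOnNhd ℂ F U) (hG : AnalyticOnNhd ℂ G U) {t₀ : ℝ} (ht₀ : (t₀ : ℂ) ∈ U)
    (h : ∀ t : ℝ, (t : ℂ) ∈ U → F t = G t) : Set.EqOn F G U := by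
  refine hF.eqOn_of_preconnected_of_frequently_eq hG hc ht₀ ?_
  have ht : Tendsto ((↑) : ℝ → ℂ) (𝓝[≠] t₀) (𝓝[≠] (t₀ : ℂ)) :=
    tendsto_nhdsWithin_of_tendsto_nhds_of_eventually_within _
      (Complex.continuous_ofReal.continuousAt.tendsto.mono_left nhdsWithin_le_nhds)
      (eventually_nhdsWithin_of_forall fun t hne => by simpa using hne)
  refine ht.frequently (Eventually.frequently ?_)
  have : ∀ᶠ t : ℝ in 𝓝 t₀, (t : ℂ) ∈ U :=
    Complex.continuous_ofReal.continuousAt.eventually (hU.mem_nhds ht₀)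
  exact (this.filter_mono nhdsWithin_le_nhds).mono h

lemma ofReal_re_mem_ball {x r : ℝ} {z : ℂ} (hz : z ∈ Metric.ball (x : ℂ) r) :
    ((z.re : ℝ) : ℂ) ∈ Metric.ball (x : ℂ) r := by
  rw [mem_ball_iff_norm] at hz ⊢
  refine lt_of_le_of_lt ?_ hz
  rw [← Complex.ofReal_sub, Complex.norm_real]
  simpa using Complex.abs_re_le_norm (z - x)

lemma conj_mem_ball {x r : ℝ} {z : ℂ} (hz : z ∈ Metric.ball (x : ℂ) r) :
    conj z ∈ Metric.ball (x : ℂ) r := by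
  rw [mem_ball_iff_norm] at hz ⊢
  have : conj z - (x : ℂ) = conj (z - x) := by simp
  rwa [this, Complex.norm_conj]

/-- The local extensions on discs with real centres agree on overlaps: the overlap is convex and
contains the real part of each of its points. Hence they glue. -/
lemma exists_isHolomorphicExtension {f : ℝ → ℝ} {S : Set ℝ} (hf : AnalyticOnNhd ℝ f S) :
    ∃ (D : Set ℂ) (ε : ℂ → ℂ), IsHolomorphicExtension f S D ε := by
  have hloc : ∀ x : S, ∃ (F : ℂ → ℂ) (r : ℝ), 0 < r ∧
      AnalyticOnNhd ℂ F (Metric.ball ((x : ℝ) : ℂ) r) ∧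
      ∀ t : ℝ, (t : ℂ) ∈ Metric.ball ((x : ℝ) : ℂ) r → F t = f t := by
    rintro ⟨x, hx⟩
    obtain ⟨F, hF, hFf⟩ := exists_analyticAt_eventually_eq_ofReal (hf x hx)
    obtain ⟨r₁, hr₁, h₁⟩ := Metric.eventually_nhds_iff_ball.mp hF.eventually_analyticAt
    obtain ⟨r₂, hr₂, h₂⟩ := Metric.eventually_nhds_iff_ball.mp hFf
    refine ⟨F, min r₁ r₂, lt_min hr₁ hr₂, fun z hz => ?_, fun t ht => ?_⟩
    · exact h₁ z (Metric.ball_subset_ball (min_le_left _ _) hz)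
    · have := Metric.ball_subset_ball (min_le_right _ _) ht
      rw [mem_ball_iff_norm, ← Complex.ofReal_sub, Complex.norm_real] at this
      exact h₂ t (mem_ball_iff_norm.mpr this)
  choose F r hr hFan hFf using hloc
  set B : S → Set ℂ := fun x => Metric.ball ((x : ℝ) : ℂ) (r x)
  have hagree : ∀ x y z, z ∈ B x → z ∈ B y → F x z = F y z := by
    intro x y z hx hy
    exact eqOn_of_eq_on_reals (Metric.isOpen_ball.inter Metric.isOpen_ball)
      ((convex_ball _ _).inter (convex_ball _ _)).isPreconnected
      ((hFan x).mono Set.inter_subset_left) ((hFan y).mono Set.inter_subset_right)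
      (t₀ := z.re) ⟨ofReal_re_mem_ball hx, ofReal_re_mem_ball hy⟩
      (fun t ht => (hFf x t ht.1).trans (hFf y t ht.2).symm) ⟨hx, hy⟩
  have hconj : ∀ x z, z ∈ B x → F x (conj z) = conj (F x z) := by
    intro x z hz
    have hG : DifferentiableOn ℂ (conj ∘ F x ∘ conj) (B x) := by
      intro w hw
      have hd := (hFan x _ (conj_mem_ball hw)).differentiableAt
      have := hd.conj_conj
      rw [Complex.conj_conj] at this
      exact this.differentiableWithinAt
    have := eqOn_of_eq_on_reals Metric.isOpen_ball (convex_ball _ _).isPreconnected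
      (hG.analyticOnNhd Metric.isOpen_ball) (hFan x) (t₀ := x) (Metric.mem_ball_self (hr x))
      (fun t ht => by simp [hFf x t ht]) hz
    rw [← this]
    simp
  classical
  set ε : ℂ → ℂ := fun z => if h : ∃ x, z ∈ B x then F h.choose z else 0 with hε
  have hεF : ∀ x z, z ∈ B x → ε z = F x z := by
    intro x z hz
    have h : ∃ x, z ∈ B x := ⟨x, hz⟩
    rw [hε]
    simp only [dif_pos h]
    exact hagree _ _ _ h.choose_spec hz
  have hB : ∀ x : S, ((x : ℝ) : ℂ) ∈ B x := fun x => Metric.mem_ball_self (hr x)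
  refine ⟨⋃ x, B x, ε, ?_, ?_, ?_, ?_, ?_, ?_⟩
  · exact isOpen_iUnion fun x => Metric.isOpen_ball
  · intro z hz
    obtain ⟨x, hx⟩ := Set.mem_iUnion.mp hz
    exact Set.mem_iUnion.mpr ⟨x, conj_mem_ball hx⟩
  · exact fun x hx => Set.mem_iUnion.mpr ⟨⟨x, hx⟩, hB ⟨x, hx⟩⟩
  · intro z hz
    obtain ⟨x, hx⟩ := Set.mem_iUnion.mp hz
    refine DifferentiableAt.differentiableWithinAt ?_
    refine (hFan x z hx).differentiableAt.congr_of_eventuallyEq ?_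
    filter_upwards [Metric.isOpen_ball.mem_nhds hx] with w hw using hεF x w hw
  · exact fun x hx => (hεF ⟨x, hx⟩ x (hB ⟨x, hx⟩)).trans (hFf ⟨x, hx⟩ x (hB ⟨x, hx⟩))
  · intro z hz
    obtain ⟨x, hx⟩ := Set.mem_iUnion.mp hz
    rw [hεF x z hx, hεF x _ (conj_mem_ball hx), hconj x z hx]

end Extension

/-! ### A compactness criterion -/

lemma hasSum_norm_sq_inner {H κ : Type*} [NormedAddCommGroup H] [InnerProductSpace ℂ H]
    (B : HilbertBasis κ ℂ H) (x : H) : HasSum (fun n => ‖inner ℂ (B n) x‖ ^ 2) (‖x‖ ^ 2) := by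
  have h := Complex.reCLM.hasSum (B.hasSum_inner_mul_inner x x)
  have h1 : ∀ n, Complex.reCLM (inner ℂ x (B n) * inner ℂ (B n) x) = ‖inner ℂ (B n) x‖ ^ 2 := by
    intro n
    rw [← inner_conj_symm x (B n), ← Complex.normSq_eq_conj_mul_self, Complex.reCLM_apply,
      Complex.ofReal_re, Complex.normSq_eq_norm_sq]
  have h2 : Complex.reCLM (inner ℂ x x) = ‖x‖ ^ 2 := (norm_sq_eq_re_inner (𝕜 := ℂ) x).symm
  simpa only [Function.comp_def, h1, h2] using h

/-- A bounded operator `A` is compact if its coefficients `⟨Bₙ, A u⟩` with respect to a Hilbert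
basis, multiplied by weights that tend to infinity, are dominated by the coefficients of
finitely many bounded operators: the truncations to finitely many coefficients converge to `A`
in norm. -/
lemma isCompactOperator_of_weighted_coefficients {V H κ ι : Type*} [NormedAddCommGroup V]
    [NormedSpace ℂ V] [NormedAddCommGroup H] [InnerProductSpace ℂ H] [CompleteSpace H] [Fintype ι]
    (B : HilbertBasis κ ℂ H) (A : V →L[ℂ] H) (G : ι → V →L[ℂ] H) (w : κ → ℝ)
    (hw : Tendsto w cofinite atTop)
    (h : ∀ u n, w n * ‖inner ℂ (B n) (A u)‖ ^ 2 ≤ ∑ j, ‖inner ℂ (B n) (G j u)‖ ^ 2) :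
    IsCompactOperator A := by
  classical
  set F : Finset κ → V →L[ℂ] H := fun s =>
    ∑ n ∈ s, ((innerSL ℂ (B n)).comp A).smulRight (B n) with hF
  have hFapply : ∀ s u, F s u = ∑ n ∈ s, inner ℂ (B n) (A u) • B n := by
    intro s u
    simp [hF, sum_apply]
  have hFcompact : ∀ s, IsCompactOperator (F s) := by
    intro s
    have hs : ∀ n, IsCompactOperator (((innerSL ℂ (B n)).comp A).smulRight (B n)) := fun n =>
      (isCompactOperator_of_locallyCompactSpace_rng
        (ContinuousLinearMap.toSpanSingleton ℂ (B n))).comp_clm ((innerSL ℂ (B n)).comp A)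
    exact Submodule.sum_mem (compactOperator (RingHom.id ℂ) V H) fun n _ => hs n
  have hcoeff : ∀ s u n, inner ℂ (B n) ((A - F s) u) = if n ∈ s then 0 else inner ℂ (B n) (A u) := by
    intro s u n
    rw [sub_apply, hFapply, inner_sub_right]
    split_ifs with hn
    · rw [B.orthonormal.inner_right_sum _ hn, sub_self]
    · rw [inner_sum, Finset.sum_eq_zero, sub_zero]
      intro m hm
      rw [inner_smul_right, B.orthonormal.inner_eq_zero (ne_of_mem_of_not_mem hm hn).symm,
        mul_zero]
  refine isCompactOperator_of_tendsto (F := F) (l := atTop) ?_ (Eventually.of_forall hFcompact)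
  set M : ℝ := ∑ j, ‖G j‖ ^ 2 with hM
  have hM0 : 0 ≤ M := by positivity
  rw [Metric.tendsto_atTop]
  intro ε hε
  -- Outside a finite set the weights are at least `R`, chosen so that `M / R ≤ (ε / 2)²`.
  set R : ℝ := (M + 1) * (2 / ε) ^ 2
  have hR : 0 < R := by positivity
  have hfin : {n | ¬ R ≤ w n}.Finite := hw.eventually_ge_atTop R
  refine ⟨hfin.toFinset, fun s hs => ?_⟩
  have hbound : ‖A - F s‖ ≤ ε / 2 := by
    refine ContinuousLinearMap.opNorm_le_bound _ (by positivity) fun u => ?_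
    have hsum := hasSum_norm_sq_inner B ((A - F s) u)
    have hsum' : HasSum (fun n => ∑ j, ‖inner ℂ (B n) (G j u)‖ ^ 2) (∑ j, ‖G j u‖ ^ 2) :=
      hasSum_sum fun j _ => hasSum_norm_sq_inner B (G j u)
    have hle : R * ‖(A - F s) u‖ ^ 2 ≤ ∑ j, ‖G j u‖ ^ 2 := by
      refine hasSum_le (fun n => ?_) (hsum.mul_left R) hsum'
      rw [hcoeff]
      split_ifs with hn
      · rw [norm_zero, zero_pow two_ne_zero, mul_zero]
        positivity
      · have hwn : R ≤ w n := by
          by_contra hcon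
          exact hn (hs (hfin.mem_toFinset.mpr hcon))
        refine le_trans ?_ (h u n)
        gcongr
    have hG : ∑ j, ‖G j u‖ ^ 2 ≤ M * ‖u‖ ^ 2 := by
      rw [hM, Finset.sum_mul]
      refine Finset.sum_le_sum fun j _ => ?_
      rw [← mul_pow]
      exact pow_le_pow_left₀ (norm_nonneg _) ((G j).le_opNorm u) 2
    have hsq : ‖(A - F s) u‖ ^ 2 ≤ (ε / 2 * ‖u‖) ^ 2 := by
      refine le_of_mul_le_mul_left ?_ hR
      calc R * ‖(A - F s) u‖ ^ 2 ≤ M * ‖u‖ ^ 2 := hle.trans hG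
        _ ≤ (M + 1) * ‖u‖ ^ 2 := by gcongr; linarith
        _ = R * (ε / 2 * ‖u‖) ^ 2 := by simp only [R]; field_simp
    exact pow_le_pow_iff_left₀ (norm_nonneg _) (by positivity) two_ne_zero |>.mp hsq
  rw [dist_eq_norm, norm_sub_rev]
  linarith

/-! ### Characters of the plane modulo a lattice -/

section Lattice

variable {ι : Type*} (b : Module.Basis ι ℝ Plane)

/-- The projection of the plane onto the torus given by the coordinates modulo `1` with respect to
a basis. -/
noncomputable def torusMap (x : Plane) : UnitAddTorus ι := fun i => (b.repr x i : UnitAddCircle)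

lemma torusMap_eq_iff {Λ : Submodule ℤ Plane} (hb : Submodule.span ℤ (Set.range b) = Λ)
    [Finite ι] (x y : Plane) : torusMap b x = torusMap b y ↔ x - y ∈ Λ := by
  rw [← hb, b.mem_span_iff_repr_mem ℤ, funext_iff]
  refine forall_congr' fun i => ?_
  rw [torusMap, torusMap, ← sub_eq_zero, ← AddCircle.coe_sub, AddCircle.coe_eq_zero_iff, map_sub,
    Finsupp.sub_apply]
  simp

lemma continuous_torusMap [Finite ι] : Continuous (torusMap b) := by
  refine continuous_pi fun i => (AddCircle.continuous_mk' 1).comp ?_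
  exact (b.coord i).continuous_of_finiteDimensional

variable [Fintype ι]

/-- The measurable section of `torusMap b` with values in a half-open period cell. -/
noncomputable def torusSection (t : UnitAddTorus ι) : Plane :=
  ∑ i, ((AddCircle.equivIoc 1 0 (t i) : ℝ)) • b i

lemma torusMap_torusSection (t : UnitAddTorus ι) : torusMap b (torusSection b t) = t := by
  ext i
  have h : b.repr (torusSection b t) i = (AddCircle.equivIoc 1 0 (t i) : ℝ) := by
    rw [torusSection, b.repr_sum_self]
  rw [torusMap, h]
  exact (AddCircle.equivIoc 1 0).symm_apply_apply (t i)

lemma measurable_torusSection : Measurable (torusSection b) := by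
  refine Finset.measurable_sum _ fun i _ => Measurable.smul_const ?_ _
  exact measurable_subtype_coe.comp
    ((AddCircle.measurableEquivIoc 1 0).measurable.comp (measurable_pi_apply i))

/-- The character `x ↦ exp(2πi ∑ᵢ nᵢ xᵢ)` of the plane, `xᵢ` being the coordinates with respect to
the basis `b`. -/
noncomputable def latticeChar (n : ι → ℤ) (x : Plane) : ℂ :=
  UnitAddTorus.mFourier n (torusMap b x)

/-- The linear functional `x ↦ ∑ᵢ nᵢ xᵢ`. -/
noncomputable def frequency (n : ι → ℤ) : Plane →L[ℝ] ℝ :=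
  LinearMap.toContinuousLinearMap (∑ i, (n i : ℝ) • b.coord i)

lemma frequency_apply (n : ι → ℤ) (x : Plane) : frequency b n x = ∑ i, n i * b.repr x i := by
  simp [frequency]

lemma frequency_basis (n : ι → ℤ) (i : ι) : frequency b n (b i) = n i := by
  classical
  simp [frequency_apply, Finsupp.single_apply]

lemma frequency_neg (n : ι → ℤ) : frequency b (-n) = - frequency b n := by
  ext x
  simp [frequency_apply]

lemma latticeChar_eq_exp (n : ι → ℤ) (x : Plane) :
    latticeChar b n x = Complex.exp (2 * Real.pi * Complex.I * (frequency b n x : ℂ)) := by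
  change ∏ i, fourier (n i) ((b.repr x i : ℝ) : UnitAddCircle) = _
  simp only [fourier_coe_apply, ← Complex.exp_sum, frequency_apply]
  congr 1
  push_cast
  rw [Finset.mul_sum]
  refine Finset.sum_congr rfl fun i _ => ?_
  ring

lemma latticeChar_add (n : ι → ℤ) (x y : Plane) :
    latticeChar b n (x + y) = latticeChar b n x * latticeChar b n y := by
  rw [latticeChar_eq_exp, latticeChar_eq_exp, latticeChar_eq_exp, ← Complex.exp_add, map_add]
  congr 1
  push_cast
  ring

lemma latticeChar_add_of_mem {Λ : Submodule ℤ Plane} (hb : Submodule.span ℤ (Set.range b) = Λ)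
    (n : ι → ℤ) {l : Plane} (hl : l ∈ Λ) (x : Plane) :
    latticeChar b n (x + l) = latticeChar b n x := by
  rw [latticeChar, latticeChar, (torusMap_eq_iff b hb (x + l) x).mpr (by simpa using hl)]

lemma conj_latticeChar (n : ι → ℤ) (x : Plane) :
    conj (latticeChar b n x) = latticeChar b (-n) x :=
  UnitAddTorus.mFourier_neg.symm

lemma latticeChar_neg_mul (m n : ι → ℤ) (x : Plane) :
    latticeChar b (-m) x * latticeChar b n x = latticeChar b (-m + n) x :=
  UnitAddTorus.mFourier_add.symm

lemma latticeChar_zero (x : Plane) : latticeChar b 0 x = 1 := by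
  rw [latticeChar, UnitAddTorus.mFourier_zero, ContinuousMap.one_apply]

lemma norm_latticeChar (n : ι → ℤ) (x : Plane) : ‖latticeChar b n x‖ = 1 := by
  rw [latticeChar_eq_exp, show 2 * Real.pi * Complex.I * (frequency b n x : ℂ)
    = ((2 * Real.pi * frequency b n x : ℝ) : ℂ) * Complex.I by push_cast; ring,
    Complex.norm_exp_ofReal_mul_I]

lemma contDiff_latticeChar (n : ι → ℤ) : ContDiff ℝ (⊤ : ℕ∞) (latticeChar b n) := by
  rw [show latticeChar b n = _ from funext (latticeChar_eq_exp b n)]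
  exact (contDiff_const.mul
    (Complex.ofRealCLM.contDiff.comp (frequency b n).contDiff)).cexp

lemma partialDeriv_latticeChar (n : ι → ℤ) (j : Fin 2) (x : Plane) :
    partialDeriv j (latticeChar b n) x
      = 2 * Real.pi * Complex.I * (frequency b n (EuclideanSpace.single j 1) : ℂ)
        * latticeChar b n x := by
  have h1 : HasFDerivAt (fun x : Plane => 2 * Real.pi * Complex.I * (frequency b n x : ℂ))
      ((2 * Real.pi * Complex.I : ℂ) • Complex.ofRealCLM.comp (frequency b n)) x :=
    (Complex.ofRealCLM.hasFDerivAt.comp x (frequency b n).hasFDerivAt).const_mul _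
  rw [partialDeriv, show latticeChar b n = _ from funext (latticeChar_eq_exp b n),
    h1.cexp.fderiv]
  simp
  ring

/-- A character with a nonzero index takes the value `-1`. -/
lemma exists_latticeChar_eq_neg_one {n : ι → ℤ} (hn : n ≠ 0) : ∃ a, latticeChar b n a = -1 := by
  obtain ⟨i, hi⟩ := Function.ne_iff.mp hn
  have hi' : (n i : ℂ) ≠ 0 := by exact_mod_cast hi
  refine ⟨(2 * (n i : ℝ))⁻¹ • b i, ?_⟩
  rw [latticeChar_eq_exp, map_smul, frequency_basis, ← Complex.exp_pi_mul_I]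
  congr 1
  push_cast [smul_eq_mul]
  field_simp

/-- The frequencies control the indices: `∑ᵢ nᵢ² ≤ C ∑ⱼ ℓₙ(eⱼ)²`. -/
lemma sum_sq_le_frequency (n : ι → ℤ) :
    ∑ i, (n i : ℝ) ^ 2 ≤ (∑ i, ‖b i‖ ^ 2) *
      ∑ j : Fin 2, frequency b n (EuclideanSpace.single j 1) ^ 2 := by
  rw [Finset.sum_mul]
  refine Finset.sum_le_sum fun i _ => ?_
  have h1 : (n i : ℝ) = ∑ j : Fin 2, b i j * frequency b n (EuclideanSpace.single j 1) := by
    have h2 : b i = ∑ j : Fin 2, b i j • EuclideanSpace.single j (1 : ℝ) := by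
      ext k
      fin_cases k <;> simp [Fin.sum_univ_two]
    rw [← frequency_basis b n i]
    conv_lhs => rw [h2]
    simp
  rw [h1, EuclideanSpace.real_norm_sq_eq]
  exact Finset.sum_mul_sq_le_sq_mul_sq _ _ _

/-- The sums of squares of the entries tend to infinity on the integer vectors. -/
lemma tendsto_sum_sq_cofinite : Tendsto (fun n : ι → ℤ => ∑ i, (n i : ℝ) ^ 2) cofinite atTop := by
  classical
  rw [tendsto_atTop]
  intro R
  obtain ⟨N, hN⟩ := exists_nat_ge R
  refine (Set.finite_Icc (fun _ : ι => -(N : ℤ)) (fun _ => (N : ℤ))).subset fun n hn => ?_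
  have hn' : ∑ i, (n i : ℝ) ^ 2 < R := not_le.mp hn
  have hi : ∀ i, |n i| ≤ N := by
    intro i
    have h1 : (n i : ℝ) ^ 2 ≤ ∑ i, (n i : ℝ) ^ 2 :=
      Finset.single_le_sum (f := fun i => (n i : ℝ) ^ 2) (fun i _ => sq_nonneg _)
        (Finset.mem_univ i)
    have h2 : (n i) ^ 2 ≤ (N : ℤ) := by exact_mod_cast (h1.trans_lt hn').le.trans hN
    have h3 : |n i| ≤ (n i) ^ 2 := by
      rw [← sq_abs]
      exact Int.le_self_sq _
    exact h3.trans h2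
  exact Set.mem_Icc.mpr ⟨fun i => (abs_le.mp (hi i)).1, fun i => (abs_le.mp (hi i)).2⟩

end Lattice

/-! ### Completeness of the characters in `L²(Ω)` -/

section Completeness

open scoped Pointwise

variable {Λ : Submodule ℤ Plane} {Ω : Set Plane} {ι : Type*} [Fintype ι]
  (b : Module.Basis ι ℝ Plane)

instance (Λ : Submodule ℤ Plane) : VAddInvariantMeasure Λ Plane volume :=
  ⟨fun l s _ => measure_preimage_add volume (l : Plane) s⟩

lemma volume_fundamentalDomain_lt_top [DiscreteTopology Λ] [IsZLattice ℝ Λ]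
    (hΩ : IsAddFundamentalDomain Λ Ω volume) : volume Ω < ⊤ := by
  have b₀ := Module.Free.chooseBasis ℤ Λ
  rw [hΩ.measure_eq (ZLattice.isAddFundamentalDomain b₀ volume)]
  exact (ZSpan.fundamentalDomain_isBounded _).measure_lt_top

lemma aestronglyMeasurable_latticeChar (n : ι → ℤ) (μ : Measure Plane) :
    AEStronglyMeasurable (latticeChar b n) μ :=
  (contDiff_latticeChar b n).continuous.aestronglyMeasurable

lemma memLp_latticeChar (hfin : volume Ω < ⊤) (n : ι → ℤ) :
    MemLp (latticeChar b n) 2 (volume.restrict Ω) := by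
  have : IsFiniteMeasure (volume.restrict Ω) := ⟨by simpa using hfin⟩
  exact MemLp.of_bound (aestronglyMeasurable_latticeChar b n _) 1
    (Eventually.of_forall fun x => (norm_latticeChar b n x).le)

lemma isPeriodicTest_latticeChar (hb : Submodule.span ℤ (Set.range b) = Λ) (hfin : volume Ω < ⊤)
    (n : ι → ℤ) : IsPeriodicTest Λ Ω (latticeChar b n) where
  smooth := contDiff_latticeChar b n
  periodic l hl x := latticeChar_add_of_mem b hb n hl x
  memLp := memLp_latticeChar b hfin n
  memLp_partialDeriv j := by
    rw [show partialDeriv j (latticeChar b n) = _ from funext (partialDeriv_latticeChar b n j)]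
    exact (memLp_latticeChar b hfin n).const_mul _

/-- The mean of a nontrivial character over a fundamental domain vanishes: translating the domain
does not change the mean, but it can multiply the character by `-1`. -/
lemma integral_latticeChar_eq_zero [Countable Λ] (hb : Submodule.span ℤ (Set.range b) = Λ)
    (hΩ : IsAddFundamentalDomain Λ Ω volume) {n : ι → ℤ} (hn : n ≠ 0) :
    ∫ x in Ω, latticeChar b n x = 0 := by
  obtain ⟨a, ha⟩ := exists_latticeChar_eq_neg_one b hn
  have h1 : ∫ x in a +ᵥ Ω, latticeChar b n x = ∫ x in Ω, latticeChar b n x :=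
    (hΩ.vadd_of_comm a).setIntegral_eq hΩ fun l x => by
      rw [Submodule.vadd_def, vadd_eq_add, add_comm]
      exact latticeChar_add_of_mem b hb n l.2 x
  have h2 : ∫ x in a +ᵥ Ω, latticeChar b n x = ∫ x in Ω, latticeChar b n (a + x) :=
    (measurePreserving_vadd a volume).setIntegral_image_emb (measurableEmbedding_const_vadd a) _ _
  simp only [latticeChar_add, ha, integral_const_mul] at h2
  have h3 := h1.symm.trans h2
  rw [neg_one_mul] at h3
  exact self_eq_neg.mp h3

/-- The union of the lattice translates of a measurable subset `A` of a fundamental domain meets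
the fundamental domain in `A` only, up to a null set. -/
lemma ae_mem_hull_iff [Countable Λ] (hΩ : IsAddFundamentalDomain Λ Ω volume)
    {A : Set Plane} (hA : A ⊆ Ω) :
    ∀ᵐ x ∂(volume.restrict Ω), x ∈ (⋃ l : Λ, l +ᵥ A) ↔ x ∈ A := by
  have h0 : ∀ᵐ x, ∀ l : Λ, l ≠ 0 → x ∉ (l +ᵥ Ω) ∩ Ω := by
    rw [ae_all_iff]
    intro l
    by_cases hl : l = 0
    · simp [hl]
    · have h := hΩ.aedisjoint hl
      simp only [Function.onFun, zero_vadd] at h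
      filter_upwards [measure_eq_zero_iff_ae_notMem.mp h] with x hx _ using hx
  have hmem : ∀ᵐ x ∂(volume.restrict Ω), x ∈ Ω := ae_restrict_mem₀ hΩ.nullMeasurableSet
  filter_upwards [ae_restrict_of_ae h0, hmem] with x hx hxΩ
  constructor
  · intro h
    obtain ⟨l, hl⟩ := Set.mem_iUnion.mp h
    by_cases hl0 : l = 0
    · simpa [hl0] using hl
    · exact absurd ⟨Set.vadd_set_mono hA hl, hxΩ⟩ (hx l hl0)
  · exact fun h => Set.mem_iUnion.mpr ⟨0, by simpa using h⟩

/-- A measurable subset of the fundamental domain is, up to a null set, the preimage of a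
measurable subset of the torus. -/
lemma exists_torus_preimage [Countable Λ] (hb : Submodule.span ℤ (Set.range b) = Λ)
    (hΩ : IsAddFundamentalDomain Λ Ω volume) (hΩm : MeasurableSet Ω) {A : Set Plane}
    (hA : MeasurableSet A) : ∃ E : Set (UnitAddTorus ι), MeasurableSet E ∧
      torusMap b ⁻¹' E =ᵐ[volume.restrict Ω] A := by
  set H : Set Plane := ⋃ l : Λ, l +ᵥ (A ∩ Ω) with hH
  have hHm : MeasurableSet H := MeasurableSet.iUnion fun l => (hA.inter hΩm).const_vadd l
  have hHinv : ∀ x y, x - y ∈ Λ → y ∈ H → x ∈ H := by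
    intro x y hxy hy
    obtain ⟨l, z, hz, rfl⟩ := Set.mem_iUnion.mp hy
    refine Set.mem_iUnion.mpr ⟨⟨x - (l +ᵥ z), hxy⟩ + l, z, hz, ?_⟩
    simp only [Submodule.vadd_def, vadd_eq_add, Submodule.coe_add]
    abel
  refine ⟨torusSection b ⁻¹' H, measurable_torusSection b hHm, ?_⟩
  filter_upwards [ae_mem_hull_iff hΩ (Set.inter_subset_right (s := A)),
    ae_restrict_mem₀ hΩ.nullMeasurableSet] with x hx hxΩ
  have h1 : torusSection b (torusMap b x) - x ∈ Λ :=
    (torusMap_eq_iff b hb _ _).mp (torusMap_torusSection b _)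
  have h2 : torusSection b (torusMap b x) ∈ H ↔ x ∈ H :=
    ⟨hHinv _ _ (by simpa using Λ.neg_mem h1), hHinv _ _ h1⟩
  refine propext ?_
  change torusSection b (torusMap b x) ∈ H ↔ x ∈ A
  rw [h2, hx, Set.mem_inter_iff, and_iff_left hxΩ]

/-- The characters span a dense subspace of `L²(Ω)`: trigonometric polynomials are dense in `L²` of
the torus for the image of the Lebesgue measure on `Ω`, and every indicator function on `Ω` comes
from the torus. -/
lemma span_latticeChar_closure_eq_top [Countable Λ] (hb : Submodule.span ℤ (Set.range b) = Λ)
    (hΩ : IsAddFundamentalDomain Λ Ω volume) (hΩm : MeasurableSet Ω) (hfin : volume Ω < ⊤) :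
    (Submodule.span ℂ (Set.range fun n : ι → ℤ =>
      ((memLp_latticeChar b hfin n).toLp _ : L2 Ω))).topologicalClosure = ⊤ := by
  have hfinite : IsFiniteMeasure (volume.restrict Ω) := ⟨by simpa using hfin⟩
  set μ : Measure (UnitAddTorus ι) := (volume.restrict Ω).map (torusMap b) with hμ
  have hmeas : Measurable (torusMap b) := (continuous_torusMap b).measurable
  have hmp : MeasurePreserving (torusMap b) (volume.restrict Ω) μ := ⟨hmeas, rfl⟩
  have hμfin : IsFiniteMeasure μ := Measure.isFiniteMeasure_map _ _
  set pull : Lp ℂ 2 μ →L[ℂ] L2 Ω :=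
    (Lp.compMeasurePreservingₗᵢ ℂ (torusMap b) hmp).toContinuousLinearMap with hpull
  set W := (Submodule.span ℂ (Set.range fun n : ι → ℤ =>
      ((memLp_latticeChar b hfin n).toLp _ : L2 Ω))).topologicalClosure with hW
  have hdense : (Submodule.span ℂ (Set.range fun n : ι → ℤ =>
      ContinuousMap.toLp (E := ℂ) 2 μ ℂ (UnitAddTorus.mFourier n))).topologicalClosure = ⊤ := by
    simpa only [Submodule.map_span, ContinuousLinearMap.coe_coe, ← Set.range_comp,
      Function.comp_def] using
      (ContinuousMap.toLp_denseRange (p := 2) ℂ μ ℂ ENNReal.ofNat_ne_top).topologicalClosure_map_submodule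
        UnitAddTorus.span_mFourier_closure_eq_top
  have hrange : ∀ g, pull g ∈ W := by
    intro g
    have hg : g ∈ (Submodule.span ℂ (Set.range fun n : ι → ℤ =>
        ContinuousMap.toLp (E := ℂ) 2 μ ℂ (UnitAddTorus.mFourier n))).topologicalClosure :=
      hdense ▸ Submodule.mem_top
    have hle : (Submodule.span ℂ (Set.range fun n : ι → ℤ =>
        ContinuousMap.toLp (E := ℂ) 2 μ ℂ (UnitAddTorus.mFourier n))).topologicalClosure
        ≤ W.comap (pull : Lp ℂ 2 μ →ₗ[ℂ] L2 Ω) := by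
      refine Submodule.topologicalClosure_minimal _ (Submodule.span_le.mpr ?_)
        ((Submodule.isClosed_topologicalClosure _).preimage pull.continuous)
      rintro _ ⟨n, rfl⟩
      have he : pull (ContinuousMap.toLp (E := ℂ) 2 μ ℂ (UnitAddTorus.mFourier n))
          = (memLp_latticeChar b hfin n).toLp _ := by
        refine Lp.ext ?_
        have e1 := Lp.coeFn_compMeasurePreserving
          (ContinuousMap.toLp (E := ℂ) 2 μ ℂ (UnitAddTorus.mFourier n)) hmp
        have e2 := hmp.quasiMeasurePreserving.ae_eq_comp
          (ContinuousMap.coeFn_toLp (p := 2) (𝕜 := ℂ) μ (UnitAddTorus.mFourier (d := ι) n))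
        exact e1.trans (e2.trans (memLp_latticeChar b hfin n).coeFn_toLp.symm)
      change pull _ ∈ W
      rw [he]
      exact Submodule.le_topologicalClosure _ (Submodule.subset_span ⟨n, rfl⟩)
    exact hle hg
  rw [eq_top_iff]
  rintro f -
  refine Lp.induction ENNReal.ofNat_ne_top (fun f : L2 Ω => f ∈ W) ?_ ?_
    (Submodule.isClosed_topologicalClosure _) f
  · intro c A hA hAfin
    obtain ⟨E, hE, hEA⟩ := exists_torus_preimage b hb hΩ hΩm hA
    have he : (Lp.simpleFunc.indicatorConst 2 hA hAfin.ne c : L2 Ω)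
        = pull (indicatorConstLp 2 hE (measure_ne_top μ E) c) := by
      rw [Lp.simpleFunc.coe_indicatorConst]
      refine Lp.ext (indicatorConstLp_coeFn.trans ?_)
      change _ =ᵐ[_] (Lp.compMeasurePreserving (torusMap b) hmp
        (indicatorConstLp 2 hE (measure_ne_top μ E) c) : L2 Ω)
      rw [Lp.indicatorConstLp_compMeasurePreserving]
      refine EventuallyEq.trans ?_ indicatorConstLp_coeFn.symm
      exact indicator_ae_eq_of_ae_eq_set hEA.symm
    rw [he]
    exact hrange _
  · intro f g hf hg _ h1 h2
    exact W.add_mem h1 h2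

lemma inner_toLp_latticeChar (hfin : volume Ω < ⊤) (n : ι → ℤ) (f : L2 Ω) :
    inner ℂ ((memLp_latticeChar b hfin n).toLp _) f = ∫ x in Ω, f x * latticeChar b (-n) x := by
  rw [L2.inner_def]
  refine integral_congr_ae ?_
  filter_upwards [(memLp_latticeChar b hfin n).coeFn_toLp] with x hx
  rw [hx, RCLike.inner_apply, conj_latticeChar]

lemma inner_latticeChar [Countable Λ] (hb : Submodule.span ℤ (Set.range b) = Λ)
    (hΩ : IsAddFundamentalDomain Λ Ω volume) (hfin : volume Ω < ⊤) (m n : ι → ℤ) [Decidable (m = n)] :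
    inner ℂ ((memLp_latticeChar b hfin m).toLp _ : L2 Ω) ((memLp_latticeChar b hfin n).toLp _)
      = if m = n then ((volume Ω).toReal : ℂ) else 0 := by
  have h : inner ℂ ((memLp_latticeChar b hfin m).toLp _ : L2 Ω) ((memLp_latticeChar b hfin n).toLp _)
      = ∫ x in Ω, latticeChar b (-m + n) x := by
    rw [inner_toLp_latticeChar b hfin]
    refine integral_congr_ae ?_
    filter_upwards [(memLp_latticeChar b hfin n).coeFn_toLp] with x hx
    rw [hx, mul_comm, latticeChar_neg_mul]
  rw [h]
  split_ifs with hmn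
  · simp [hmn, latticeChar_zero, Measure.real]
  · exact integral_latticeChar_eq_zero b hb hΩ fun h0 => hmn (neg_add_eq_zero.mp h0)

/-- The normalised characters form a Hilbert basis of `L²(Ω)`. -/
lemma exists_hilbertBasis_latticeChar [Countable Λ] (hb : Submodule.span ℤ (Set.range b) = Λ)
    (hΩ : IsAddFundamentalDomain Λ Ω volume) (hΩm : MeasurableSet Ω) (hfin : volume Ω < ⊤) :
    ∃ (B : HilbertBasis (ι → ℤ) ℂ (L2 Ω)) (c : ℂ),
      ∀ n, B n = c • (memLp_latticeChar b hfin n).toLp _ := by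
  classical
  have hpos : 0 < (volume Ω).toReal := ENNReal.toReal_pos (hΩ.measure_ne_zero (NeZero.ne _)) hfin.ne
  set r : ℝ := (Real.sqrt (volume Ω).toReal)⁻¹ with hr
  have hr0 : 0 < r := by positivity
  have hrr : r * (r * (volume Ω).toReal) = 1 := by
    have := Real.mul_self_sqrt hpos.le
    have hs : Real.sqrt (volume Ω).toReal ≠ 0 := (Real.sqrt_pos.mpr hpos).ne'
    rw [hr, ← this]
    simp only [Real.sqrt_mul_self (Real.sqrt_nonneg _)]
    field_simp
  have hortho : Orthonormal ℂ (fun n : ι → ℤ =>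
      (r : ℂ) • ((memLp_latticeChar b hfin n).toLp _ : L2 Ω)) := by
    rw [orthonormal_iff_ite]
    intro m n
    rw [inner_smul_left, inner_smul_right, inner_latticeChar b hb hΩ hfin, Complex.conj_ofReal]
    split_ifs
    · exact_mod_cast hrr
    · simp
  have hspan : ⊤ ≤ (Submodule.span ℂ (Set.range fun n : ι → ℤ =>
      (r : ℂ) • ((memLp_latticeChar b hfin n).toLp _ : L2 Ω))).topologicalClosure := by
    rw [← span_latticeChar_closure_eq_top b hb hΩ hΩm hfin]
    refine Submodule.topologicalClosure_mono (Submodule.span_le.mpr ?_)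
    rintro _ ⟨n, rfl⟩
    have hmem := Submodule.smul_mem _ ((r : ℂ)⁻¹)
      (Submodule.subset_span (R := ℂ) (Set.mem_range_self (f := fun n : ι → ℤ =>
        (r : ℂ) • ((memLp_latticeChar b hfin n).toLp _ : L2 Ω)) n))
    have hrc : (r : ℂ) ≠ 0 := by exact_mod_cast hr0.ne'
    rwa [smul_smul, inv_mul_cancel₀ hrc, one_smul] at hmem
  exact ⟨HilbertBasis.mk hortho hspan, r, fun n => by rw [HilbertBasis.coe_mk]⟩

/-- A weak derivative acts on the Fourier coefficients as multiplication by the frequency. -/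
lemma inner_weakPartial (hb : Submodule.span ℤ (Set.range b) = Λ) (hfin : volume Ω < ⊤)
    (n : ι → ℤ) (u : H1per Λ Ω) (j : Fin 2) :
    inner ℂ ((memLp_latticeChar b hfin n).toLp _) (weakPartial j u)
      = 2 * Real.pi * Complex.I * (frequency b n (EuclideanSpace.single j 1) : ℂ)
        * inner ℂ ((memLp_latticeChar b hfin n).toLp _) (value u) := by
  have h : ∫ x in Ω, value u x * partialDeriv j (latticeChar b (-n)) x
      = - ∫ x in Ω, weakPartial j u x * latticeChar b (-n) x :=
    u.2 _ (isPeriodicTest_latticeChar b hb hfin (-n)) j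
  rw [inner_toLp_latticeChar b hfin, inner_toLp_latticeChar b hfin, ← neg_eq_iff_eq_neg.mpr h,
    ← integral_const_mul, ← integral_neg]
  refine integral_congr_ae (Eventually.of_forall fun x => ?_)
  simp only [partialDeriv_latticeChar, frequency_neg, neg_apply]
  push_cast
  ring

end Completeness

/-- Rellich's theorem for `H¹_per(Ω)`: the weak gradient multiplies the Fourier coefficients by the
frequencies, which tend to infinity. -/
theorem isCompactOperator_value {Λ : Submodule ℤ Plane} [DiscreteTopology Λ] [IsZLattice ℝ Λ]
    {Ω : Set Plane} (hΩ : IsAddFundamentalDomain Λ Ω volume) (hΩm : MeasurableSet Ω) :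
    IsCompactOperator (value (Λ := Λ) (Ω := Ω)) := by
  have hfin := volume_fundamentalDomain_lt_top hΩ
  set b₀ := Module.Free.chooseBasis ℤ Λ
  set b := b₀.ofZLatticeBasis ℝ Λ
  have hb : Submodule.span ℤ (Set.range b) = Λ := b₀.ofZLatticeBasis_span ℝ
  obtain ⟨B, c, hB⟩ := exists_hilbertBasis_latticeChar b hb hΩ hΩm hfin
  -- The factor `K + 1` absorbs the constant in the comparison of indices and frequencies.
  set K : ℝ := ∑ i, ‖b i‖ ^ 2
  have hK : 0 ≤ K := by positivity
  refine isCompactOperator_of_weighted_coefficients B value weakPartial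
    (fun n => (K + 1)⁻¹ * ∑ i, (n i : ℝ) ^ 2)
    (tendsto_sum_sq_cofinite.const_mul_atTop (by positivity)) fun u n => ?_
  have hcoef : ∀ j, ‖inner ℂ (B n) (weakPartial j u)‖ ^ 2
      = (2 * Real.pi) ^ 2 * frequency b n (EuclideanSpace.single j 1) ^ 2
        * ‖inner ℂ (B n) (value u)‖ ^ 2 := by
    intro j
    rw [hB, inner_smul_left, inner_smul_left, inner_weakPartial b hb hfin]
    simp only [norm_mul, Complex.norm_I, Complex.norm_real, RCLike.norm_ofNat, mul_pow,
      Real.norm_eq_abs, sq_abs]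
    ring
  simp only [hcoef]
  rw [← Finset.sum_mul, ← Finset.mul_sum]
  refine mul_le_mul_of_nonneg_right ?_ (sq_nonneg _)
  set q := ∑ j : Fin 2, frequency b n (EuclideanSpace.single j 1) ^ 2
  have hq : 0 ≤ q := Finset.sum_nonneg fun j _ => sq_nonneg _
  have hpi : 1 ≤ (2 * Real.pi) ^ 2 := by nlinarith [Real.pi_gt_three]
  calc (K + 1)⁻¹ * ∑ i, (n i : ℝ) ^ 2 ≤ (K + 1)⁻¹ * (K * q) := by
        gcongr
        exact sum_sq_le_frequency b n
    _ ≤ (K + 1)⁻¹ * ((K + 1) * q) := by gcongr; linarith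
    _ = 1 * q := by field_simp
    _ ≤ (2 * Real.pi) ^ 2 * q := by gcongr

end PhotonicNewton

theorem mainTheorem3
    (Λ : Submodule ℤ PhotonicNewton.Plane) [DiscreteTopology Λ] [IsZLattice ℝ Λ]
    (Ω Ω₁ Ω₂ : Set PhotonicNewton.Plane)
    (hΩ : IsAddFundamentalDomain Λ Ω volume)
    (hΩ₁ : MeasurableSet Ω₁) (hΩ₂ : MeasurableSet Ω₂)
    (hdisj : Disjoint Ω₁ Ω₂) (hunion : Ω₁ ∪ Ω₂ = Ω)
    (k : PhotonicNewton.Plane) (α₁ : ℝ) (hα₁ : 0 < α₁)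
    (S : Set ℝ) (hS : IsOpen S) (hSconn : IsPreconnected S)
    (ε₂ : ℝ → ℝ) (hanalytic : AnalyticOnNhd ℝ ε₂ S)
    (C₀ C₁ : ℝ) (hC₀ : 0 < C₀) (hbound : ∀ ω ∈ S, C₀ ≤ |ε₂ ω| ∧ |ε₂ ω| ≤ C₁)
    (heven : ∀ ω ∈ S, ε₂ (-ω) = ε₂ ω) :
    (∃ (D : Set ℂ) (ε : ℂ → ℂ), PhotonicNewton.IsHolomorphicExtension ε₂ S D ε) ∧
    ∀ (D : Set ℂ) (ε : ℂ → ℂ), PhotonicNewton.IsHolomorphicExtension ε₂ S D ε →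
      ∀ (us : PhotonicNewton.H1per Λ Ω) (ωs : ℝ), ωs ∈ S →
        us ≠ 0 →
        PhotonicNewton.opT Λ Ω Ω₁ Ω₂ k α₁ ε ωs us = 0 →
        PhotonicNewton.IsSimpleEigenvalue (PhotonicNewton.opT Λ Ω Ω₁ Ω₂ k α₁ ε) ωs →
        ∀ y : PhotonicNewton.H1per Λ Ω, PhotonicNewton.functionalP y us ≠ 0 →
          PhotonicNewton.NewtonConvergesLocally (PhotonicNewton.opT Λ Ω Ω₁ Ω₂ k α₁ ε) D
            (PhotonicNewton.functionalP y)
            ((PhotonicNewton.functionalP y us)⁻¹ • us, (ωs : ℂ)) := by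
  refine ⟨PhotonicNewton.exists_isHolomorphicExtension hanalytic, ?_⟩
  intro D ε hε us ωs hωs _ hus hsimple y hy
  have hΩm : MeasurableSet Ω := hunion ▸ hΩ₁.union hΩ₂
  exact PhotonicNewton.newtonConvergesLocally_opT
    (PhotonicNewton.isCompactOperator_value hΩ hΩm) hε.isOpen hε.holomorphic (hε.subset ωs hωs)
    hus hsimple hy
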